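/- Let $R>0$, $D=\{z\in\mathbb C : |z|\le R\}$ and $0<\alpha<1$. Let $C^\alpha(D)$ be the set of functions $f:D\to\mathbb C$ with $\sup_{z\ne z'\in D}|f(z)-f(z')|/|z-z'|^\alpha<\infty$, and for an integer $k\ge 0$ let $C^{k+\alpha}(D)$ be the set of functions whose partial derivatives of order $k$ exist up to the boundary and belong to $C^\alpha(D)$. Put $$Tf(z)=\frac{-1}{2\pi i}\int_D\frac{f(\zeta)\,d\bar\zeta\wedge d\zeta}{\zeta-z},\qquad \bar Tf(z)=\frac{-1}{2\pi i}\int_D\frac{f(\zeta)\,d\bar\zeta\wedge d\zeta}{\bar\zeta-\bar z},$$ and let $T^\mu\bar T^\nu$ be the composition of their iterates. **Theorem.** Let $f\in C^\alpha(D)$ and let $\mu,\nu\ge 1$ be integers. Then $T^\mu\bar T^\nu f\in C^{\mu+\nu+\alpha}(D)$, and for every $z\in D$ $$T^\mu\bar T^\nu f(z)=\frac{(-1)^\mu}{(\mu-1)!\,(\nu-1)!\cdot 2\pi i}\int_D C_3(z,\eta,\mu,\nu)\,f(\eta)\,d\bar\eta\wedge d\eta,$$ where the integral converges absolutely. Here,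 for $a\neq b$ in $D$ and with the principal branch of the logarithm, $$C_3(a,b,\mu,\nu)=(\bar b-\bar a)^{\mu-1}\Big(C_1(a,b,\nu)+(a-b)^{\nu-1}\ln\frac{R^2-a\bar b}{|a-b|^2}\Big)+\sum_{l=1}^{\mu-1}\binom{\mu-1}{l}(\bar b-\bar a)^{\mu-1-l}\Big(-\frac1l(\bar a-\bar b)^l(a-b)^{\nu-1}+\frac1l C_2(a,b,l,\nu)\Big),$$ $$C_1(a,b,\nu)=\sum_{l=1}^{\nu-1}\Big(-\frac{b^l}{l}\Big)\sum_{j=0}^{\nu-1-l}\binom{\nu-1}{j}a^{\nu-1-l-j}(-b)^j,$$ $$C_2(a,b,l,\nu)=\sum_{\substack{0\le p\le l,\ 0\le q\le \nu-1\\ p\le q}}\binom lp\binom{\nu-1}q R^{2p}(-\bar b)^{l-p}(-b)^{\nu-1-q}a^{q-p},$$ and empty sums are $0$. -/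

import Mathlib

open scoped NNReal ComplexConjugate Nat

noncomputable section

namespace GreenDisk

/-- The closed disk `D = {z : |z| ≤ R}`. -/
def disk (R : ℝ) : Set ℂ := Metric.closedBall 0 R

/-- The integral over `D` of the two-form `g(ζ) dζ̄ ∧ dζ`. Since `ζ = x + i y`, one has
`dζ̄ ∧ dζ = 2 i dx ∧ dy`, and `volume` on `ℂ` is the Lebesgue area measure `dx dy`. -/
def wedgeIntegral (R : ℝ) (g : ℂ → ℂ) : ℂ :=
  2 * Complex.I * ∫ ζ in disk R, g ζ

/-- The class `C^α(D)`: the Hölder quotient `|f(z) - f(z')| / |z - z'|^α` is bounded on `D`.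
Functions on `D` are represented by functions on `ℂ`, of which only the values on `D` matter. -/
def IsHolder (α : ℝ≥0) (R : ℝ) (f : ℂ → ℂ) : Prop :=
  ∃ C : ℝ≥0, HolderOnWith C α f (disk R)

/-- The class `C^{k+α}(D)`: `f` is `k` times continuously differentiable on the closed disk in
the real sense (derivatives within `D`, so up to the boundary), and the `k`-th derivative, whose
components are the `k`-th order partial derivatives, is Hölder continuous of exponent `α`. -/
def IsHolderDiff (k : ℕ) (α : ℝ≥0) (R : ℝ) (f : ℂ → ℂ) : Prop :=
  ContDiffOn ℝ k f (disk R) ∧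
    ∃ C : ℝ≥0, HolderOnWith C α (iteratedFDerivWithin ℝ k f (disk R)) (disk R)

/-- `T f (z) = -1/(2πi) ∫_D f(ζ) / (ζ - z) dζ̄ ∧ dζ`. -/
def T (R : ℝ) (f : ℂ → ℂ) : ℂ → ℂ := fun z =>
  -1 / (2 * Real.pi * Complex.I) * wedgeIntegral R fun ζ => f ζ / (ζ - z)

/-- `T̄ f (z) = -1/(2πi) ∫_D f(ζ) / (ζ̄ - z̄) dζ̄ ∧ dζ`. -/
def Tbar (R : ℝ) (f : ℂ → ℂ) : ℂ → ℂ := fun z =>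
  -1 / (2 * Real.pi * Complex.I) * wedgeIntegral R fun ζ => f ζ / (conj ζ - conj z)

/-- `C₁(a,b,k) = ∑_{l=1}^{k-1} (-b^l / l) ∑_{j=0}^{k-1-l} binom(k-1,j) a^{k-1-l-j} (-b)^j`. -/
def C₁ (a b : ℂ) (k : ℕ) : ℂ :=
  ∑ l ∈ Finset.Icc 1 (k - 1), -(b ^ l) / (l : ℂ) *
    ∑ j ∈ Finset.range (k - 1 - l + 1),
      ((k - 1).choose j : ℂ) * a ^ (k - 1 - l - j) * (-b) ^ j

/-- `C₂(a,b,l,ν) = ∑ binom(l,p) binom(ν-1,q) R^{2p} (-b̄)^{l-p} (-b)^{ν-1-q} a^{q-p}`, summed over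
`0 ≤ p ≤ l`, `0 ≤ q ≤ ν-1`, `p ≤ q`. -/
def C₂ (R : ℝ) (a b : ℂ) (l ν : ℕ) : ℂ :=
  ∑ p ∈ Finset.range (l + 1), ∑ q ∈ Finset.range (ν - 1 + 1),
    if p ≤ q then
      (l.choose p : ℂ) * ((ν - 1).choose q : ℂ) * (R : ℂ) ^ (2 * p) *
        (-conj b) ^ (l - p) * (-b) ^ (ν - 1 - q) * a ^ (q - p)
    else 0

/-- The kernel `C₃(a,b,μ,ν)`, for `a ≠ b` in `D`. The logarithm is the principal branch: the
quotient has positive real part, as `Re (R² - a b̄) > 0` for `a ≠ b` in `D`. For `μ = 1` the sum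
over `l` is empty. -/
def C₃ (R : ℝ) (a b : ℂ) (μ ν : ℕ) : ℂ :=
  (conj b - conj a) ^ (μ - 1) *
      (C₁ a b ν + (a - b) ^ (ν - 1) *
        Complex.log (((R : ℂ) ^ 2 - a * conj b) / ((‖a - b‖ ^ 2 : ℝ) : ℂ)))
    + ∑ l ∈ Finset.Icc 1 (μ - 1),
        ((μ - 1).choose l : ℂ) * (conj b - conj a) ^ (μ - 1 - l) *
          (-1 / (l : ℂ) * (conj a - conj b) ^ l * (a - b) ^ (ν - 1)
            + 1 / (l : ℂ) * C₂ R a b l ν)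

end GreenDisk

end

namespace GreenDisk

open MeasureTheory Set

/-! ### Integrability of weakly singular kernels -/

/-! Kernel formula. Since all kernels are dominated by `1/|ζ - z|`, Fubini (`integral_kernel_swap`)
turns each composition into a single integral. Partial fractions give by induction the kernel `(η̄ -
z̄)^m/(η - z)` of `T^{m+1}` up to a constant (`T_iterate_apply`); conjugation gives that of
`T̄^{n+1}`. The kernel of the composition is then `∫ (ζ̄ - z̄)^m (ζ - w)^n / ((ζ - z)(ζ̄ - w̄))`.
Expanding `ζ̄ - z̄` about `w̄` cancels `ζ̄ - w̄` in every term but one. The cancelled terms are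
Cauchy transforms of polynomials in `ζ, ζ̄` and give `C₂`; the remaining one is reduced by recursion
on `n` to the logarithm and gives `C₁` (`integral_eq_C₃`). Every explicit integral is computed in
polar coordinates: on `|ζ| = r` one has `ζ̄ = r²/ζ`, so circle averages follow from Cauchy's
formula, and they have an explicit primitive in `r`.

Regularity. `T` gains one derivative: `∂̄Tf = f`, and `∂Tf` is the compressed Beurling transform
`Bf`. A Taylor estimate with remainder `O(|w - z|^{1+α})`, uniform up to the boundary
(`exists_taylor_T`), proves both this and the Hölder bound for `Bf`. For higher order, a Green
formula for a field tangent to the circle (`integral_tangent_eq_zero`) has no boundary term and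
expresses `Bf` through `f`, `T(∂f)` and `T` of a combination of `f` and `∂̄f` (`beurling_eq`).
Induction on the order then closes (`WirtingerHolder.cauchyTransform`). -/

lemma integrableOn_norm_sub_rpow {s : ℝ} (hs : s < 2) (z : ℂ) (ρ : ℝ) :
    IntegrableOn (fun ζ : ℂ => ‖ζ - z‖ ^ (-s)) (Metric.closedBall 0 ρ) := by
  have h1 : IntegrableOn (fun ζ : ℂ => ‖ζ‖ ^ (-s)) (Metric.ball 0 (ρ + ‖z‖ + 1)) := by
    refine integrableOn_ball_of_norm_le_rpow (C := 1) (α := s) (by simp) (by simpa using hs) ?_ ?_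
    · refine Filter.Eventually.of_forall fun x => ?_
      rw [one_mul, Real.norm_of_nonneg (by positivity)]
    · exact (measurable_norm.pow_const _).aestronglyMeasurable
  have h2 := ((integrable_indicator_iff measurableSet_ball).2 h1).comp_sub_right z
  refine (h2.integrableOn (s := Metric.closedBall 0 ρ)).congr_fun (fun ζ hζ => ?_)
    measurableSet_closedBall
  have : ζ - z ∈ Metric.ball (0 : ℂ) (ρ + ‖z‖ + 1) := by
    rw [mem_ball_zero_iff]
    have := norm_sub_le ζ z
    rw [mem_closedBall_zero_iff] at hζ
    linarith
  simp [indicator_of_mem this]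

lemma integrableOn_norm_sub_inv (z : ℂ) (ρ : ℝ) :
    IntegrableOn (fun ζ : ℂ => ‖ζ - z‖⁻¹) (Metric.closedBall 0 ρ) := by
  simpa [Real.rpow_neg_one] using integrableOn_norm_sub_rpow (s := 1) (by norm_num) z ρ

/-- Translation by `z` moves the disk into the ball of radius `2R`. The bound does not depend on
`z`, which is what the Fubini argument needs for the inner integral. -/
lemma integral_norm_sub_inv_le {R : ℝ} {z : ℂ} (hz : z ∈ disk R) :
    ∫ ζ in disk R, ‖ζ - z‖⁻¹ ≤ ∫ u in Metric.closedBall (0 : ℂ) (2 * R), ‖u‖⁻¹ := by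
  have h0 : IntegrableOn (fun u : ℂ => ‖u‖⁻¹) (Metric.closedBall 0 (2 * R)) := by
    simpa using integrableOn_norm_sub_inv 0 (2 * R)
  have h1 := (integrable_indicator_iff measurableSet_closedBall).2 h0
  rw [disk, ← integral_indicator measurableSet_closedBall,
    ← integral_indicator measurableSet_closedBall,
    ← integral_sub_right_eq_self ((Metric.closedBall (0 : ℂ) (2 * R)).indicator fun u => ‖u‖⁻¹) z]
  refine integral_mono ((integrable_indicator_iff measurableSet_closedBall).2
    (integrableOn_norm_sub_inv z R)) (h1.comp_sub_right z) fun ζ => ?_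
  by_cases hζ : ζ ∈ Metric.closedBall (0 : ℂ) R
  · have : ζ - z ∈ Metric.closedBall (0 : ℂ) (2 * R) := by
      simp only [disk, mem_closedBall_zero_iff] at *
      linarith [norm_sub_le ζ z]
    simp [indicator_of_mem hζ, indicator_of_mem this]
  · rw [indicator_of_notMem hζ]
    exact indicator_nonneg (fun _ _ => by positivity) _

/-- A function dominated by `1 / |ζ - z|` is integrable on the disk. -/
lemma integrableOn_of_norm_le_inv {R C : ℝ} {z : ℂ} {g : ℂ → ℂ}
    (hg : AEStronglyMeasurable g (volume.restrict (disk R)))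
    (hC : ∀ ζ ∈ disk R, ‖g ζ‖ ≤ C * ‖ζ - z‖⁻¹) : IntegrableOn g (disk R) :=
  Integrable.mono' ((integrableOn_norm_sub_inv z R).const_mul C) hg
    ((ae_restrict_iff' measurableSet_closedBall).2 (Filter.Eventually.of_forall hC))

/-- With the radial density `r` of the plane, the first power is integrable near `0` and the second
near infinity; the minimum is bounded by the suitable one at each end. -/
lemma integrable_min_rpow {s t C : ℝ} (hs : -2 < s) (ht : t < -2) (hC : 0 ≤ C) :
    Integrable fun u : ℂ => min (C * ‖u‖ ^ s) (‖u‖ ^ t) := by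
  rw [integrable_fun_norm_addHaar volume (f := fun r : ℝ => min (C * r ^ s) (r ^ t))]
  have hm : Measurable fun r : ℝ => min (C * r ^ s) (r ^ t) :=
    ((measurable_id.pow_const s).const_mul C).min (measurable_id.pow_const t)
  rw [← Ioc_union_Ioi_eq_Ioi (zero_le_one (α := ℝ))]
  refine IntegrableOn.union ?_ ?_
  · have h : IntegrableOn (fun r : ℝ => C * r ^ (s + 1)) (Ioc 0 1) := by
      refine Integrable.const_mul ?_ C
      exact (intervalIntegrable_iff_integrableOn_Ioc_of_le zero_le_one).1
        (intervalIntegral.intervalIntegrable_rpow' (by linarith))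
    refine Integrable.mono' h (by fun_prop)
      ((ae_restrict_iff' measurableSet_Ioc).2 (Filter.Eventually.of_forall fun r hr => ?_))
    have hr0 : 0 < r := hr.1
    rw [Real.norm_of_nonneg (by positivity), Real.rpow_add_one hr0.ne']
    simp only [Complex.finrank_real_complex, smul_eq_mul]
    norm_num
    calc r * min (C * r ^ s) (r ^ t) ≤ r * (C * r ^ s) := by gcongr; exact min_le_left _ _
      _ = C * (r ^ s * r) := by ring
  · have h := integrableOn_Ioi_rpow_of_lt (a := t + 1) (by linarith) zero_lt_one
    refine Integrable.mono' h (by fun_prop)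
      ((ae_restrict_iff' measurableSet_Ioi).2 (Filter.Eventually.of_forall fun r hr => ?_))
    have hr0 : 0 < r := zero_lt_one.trans hr
    rw [Real.norm_of_nonneg (by positivity), Real.rpow_add_one hr0.ne']
    simp only [Complex.finrank_real_complex, smul_eq_mul]
    norm_num
    calc r * min (C * r ^ s) (r ^ t) ≤ r * (r ^ t) := by gcongr; exact min_le_right _ _
      _ = r ^ t * r := by ring

/-- The larger of `a`, `b` is at least `1/2`, so its own factor is at most `2` or `4`. Replacing the
larger by the smaller in that factor instead gives the exponent `α - 3`. -/
lemma rpow_mul_inv_le_min {α a b : ℝ} (hα0 : 0 < α) (hα1 : α < 1) (ha : 0 ≤ a) (hb : 0 ≤ b)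
    (hab : 1 ≤ a + b) :
    a ^ (α - 2) * b⁻¹ ≤ min (2 * a ^ (α - 2)) (a ^ (α - 3)) + min (4 * b ^ (-1 : ℝ)) (b ^ (α - 3)) := by
  have hA : 0 ≤ min (2 * a ^ (α - 2)) (a ^ (α - 3)) := by positivity
  have hB : 0 ≤ min (4 * b ^ (-1 : ℝ)) (b ^ (α - 3)) := by positivity
  rcases ha.eq_or_lt with rfl | ha
  · rw [Real.zero_rpow (by linarith), zero_mul]; positivity
  rcases hb.eq_or_lt with rfl | hb
  · rw [inv_zero, mul_zero]; positivity
  rcases le_total a b with h | h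
  · refine le_add_of_le_of_nonneg (le_min ?_ ?_) hB
    · have : b⁻¹ ≤ 2 := by
        rw [inv_le_comm₀ hb two_pos]; linarith
      rw [mul_comm]; gcongr
    · rw [show α - 3 = α - 2 + -1 by ring, Real.rpow_add ha, Real.rpow_neg_one]
      gcongr
  · refine le_add_of_nonneg_of_le hA (le_min ?_ ?_)
    · rw [Real.rpow_neg_one]
      have h1 : a ^ (α - 2) ≤ (1 / 2 : ℝ) ^ (α - 2) :=
        Real.rpow_le_rpow_of_nonpos (by norm_num) (by linarith) (by linarith)
      have h2 : (1 / 2 : ℝ) ^ (α - 2) ≤ (1 / 2 : ℝ) ^ (-2 : ℝ) :=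
        Real.rpow_le_rpow_of_exponent_ge (by norm_num) (by norm_num) (by linarith)
      have h3 : (1 / 2 : ℝ) ^ (-2 : ℝ) = 4 := by
        rw [show (-2 : ℝ) = ((-2 : ℤ) : ℝ) by norm_num, Real.rpow_intCast]; norm_num
      gcongr
      linarith
    · rw [show α - 3 = α - 2 + -1 by ring, Real.rpow_add hb, Real.rpow_neg_one]
      gcongr ?_ * _
      exact Real.rpow_le_rpow_of_nonpos hb h (by linarith)

/-- The scaling estimate `∫ |ζ - z|^{α-2} |ζ - w|^{-1} ≤ K |z - w|^{α-1}`. -/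
lemma exists_integral_rpow_mul_inv_le {α : ℝ} (hα0 : 0 < α) (hα1 : α < 1) :
    ∃ K : ℝ, ∀ z w : ℂ, z ≠ w →
      Integrable (fun ζ : ℂ => ‖ζ - z‖ ^ (α - 2) * ‖ζ - w‖⁻¹) ∧
      ∫ ζ : ℂ, ‖ζ - z‖ ^ (α - 2) * ‖ζ - w‖⁻¹ ≤ K * ‖w - z‖ ^ (α - 1) := by
  set ψ₁ : ℂ → ℝ := fun u => min (2 * ‖u‖ ^ (α - 2)) (‖u‖ ^ (α - 3)) with hψ₁
  set ψ₂ : ℂ → ℝ := fun u => min (4 * ‖u‖ ^ (-1 : ℝ)) (‖u‖ ^ (α - 3)) with hψ₂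
  have i₁ : Integrable ψ₁ := integrable_min_rpow (by linarith) (by linarith) (by norm_num)
  have i₂ : Integrable ψ₂ := integrable_min_rpow (by norm_num) (by linarith) (by norm_num)
  refine ⟨(∫ u, ψ₁ u) + ∫ u, ψ₂ u, fun z w hzw => ?_⟩
  set d := ‖w - z‖ with hd
  have hd0 : 0 < d := norm_pos_iff.2 (sub_ne_zero.2 hzw.symm)
  have j₁ : Integrable fun ζ => ψ₁ (d⁻¹ • (ζ - z)) :=
    (i₁.comp_smul (inv_ne_zero hd0.ne')).comp_sub_right z
  have j₂ : Integrable fun ζ => ψ₂ (d⁻¹ • (ζ - w)) :=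
    (i₂.comp_smul (inv_ne_zero hd0.ne')).comp_sub_right w
  have j := (j₁.add j₂).const_mul (d ^ (α - 3))
  -- Dilation by `d⁻¹` places `z` and `w` at distance one, so the triangle inequality gives `a + b ≥
  -- 1`. Homogeneity contributes `d^{α-3}` and the Jacobian `d²`, whence `d^{α-1}`.
  have hle : ∀ ζ : ℂ, ‖ζ - z‖ ^ (α - 2) * ‖ζ - w‖⁻¹ ≤
      d ^ (α - 3) * (ψ₁ (d⁻¹ • (ζ - z)) + ψ₂ (d⁻¹ • (ζ - w))) := fun ζ => by
    have h := rpow_mul_inv_le_min hα0 hα1 (norm_nonneg (d⁻¹ • (ζ - z)))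
      (norm_nonneg (d⁻¹ • (ζ - w))) (by
        rw [norm_smul, norm_smul, ← mul_add, Real.norm_of_nonneg (by positivity),
          le_inv_mul_iff₀ hd0, mul_one, hd]
        calc ‖w - z‖ = ‖(ζ - z) - (ζ - w)‖ := by congr 1; ring
          _ ≤ _ := norm_sub_le _ _)
    refine le_trans (le_of_eq ?_) (mul_le_mul_of_nonneg_left h (by positivity))
    rw [norm_smul, norm_smul, Real.norm_of_nonneg (by positivity),
      Real.mul_rpow (by positivity) (by positivity), mul_inv, inv_inv,
      Real.inv_rpow hd0.le, show α - 3 = α - 2 + -1 by ring, Real.rpow_add hd0, Real.rpow_neg_one]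
    have : d ^ (α - 2) ≠ 0 := by positivity
    field_simp
  have hint : Integrable (fun ζ : ℂ => ‖ζ - z‖ ^ (α - 2) * ‖ζ - w‖⁻¹) := by
    refine j.mono' ?_ (Filter.Eventually.of_forall fun ζ => ?_)
    · exact Measurable.aestronglyMeasurable (by fun_prop)
    · rw [Real.norm_of_nonneg (by positivity)]
      exact hle ζ
  refine ⟨hint, (integral_mono hint j hle).trans (le_of_eq ?_)⟩
  have e : ∀ (ψ : ℂ → ℝ) (v : ℂ), ∫ ζ, ψ (d⁻¹ • (ζ - v)) = d ^ (2 : ℝ) * ∫ u, ψ u := fun ψ v => by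
    rw [integral_sub_right_eq_self (fun ζ => ψ (d⁻¹ • ζ)) v, Measure.integral_comp_smul]
    simp [abs_of_pos, hd0]
  simp only [Pi.add_apply]
  rw [integral_const_mul, integral_add j₁ j₂, e, e, ← mul_add, ← mul_assoc, ← Real.rpow_add hd0,
    mul_comm]
  congr 2; ring

/-! ### Polar coordinates on the disk -/

lemma polarCoord_symm_eq_circleMap (p : ℝ × ℝ) :
    Complex.polarCoord.symm p = circleMap 0 p.1 p.2 := by
  simp [circleMap, Complex.exp_mul_I]

lemma integrableOn_polar {G : ℂ → ℂ} (hG : Integrable G) :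
    IntegrableOn (fun p : ℝ × ℝ => p.1 • G (circleMap 0 p.1 p.2)) (Ioi 0 ×ˢ Ioo (-Real.pi) Real.pi) := by
  have h1 : Integrable (G ∘ Complex.measurableEquivRealProd.symm) :=
    (Complex.volume_preserving_equiv_real_prod.symm).integrable_comp_of_integrable hG
  have h2 : IntegrableOn (G ∘ Complex.measurableEquivRealProd.symm)
      (polarCoord.symm '' polarCoord.target) := h1.integrableOn
  rw [integrableOn_image_iff_integrableOn_abs_det_fderiv_smul volume
    polarCoord.open_target.measurableSet
    (fun p _ => (hasFDerivAt_polarCoord_symm p).hasFDerivWithinAt) polarCoord.symm.injOn] at h2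
  refine h2.congr_fun (fun p hp => ?_) polarCoord.open_target.measurableSet
  have hp0 : 0 < p.1 := hp.1
  simp only [det_fderivPolarCoordSymm, abs_of_pos hp0, Function.comp_apply,
    Complex.measurableEquivRealProd_symm_polarCoord_symm_apply, polarCoord_symm_eq_circleMap]

lemma circleMap_zero_mem_disk {R r : ℝ} (hr : 0 ≤ r) (θ : ℝ) : circleMap 0 r θ ∈ disk R ↔ r ≤ R := by
  simp [disk, abs_of_nonneg hr]

/-- The rectangle of polar coordinates of the disk. -/
def polarRect (R : ℝ) : Set (ℝ × ℝ) := Ioc 0 R ×ˢ Ioo (-Real.pi) Real.pi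

lemma measurableSet_polarRect (R : ℝ) : MeasurableSet (polarRect R) :=
  measurableSet_Ioc.prod measurableSet_Ioo

lemma polarRect_subset (R : ℝ) : polarRect R ⊆ Ioi 0 ×ˢ Ioo (-Real.pi) Real.pi :=
  prod_mono Ioc_subset_Ioi_self subset_rfl

lemma integrableOn_polarRect {R : ℝ} {F : ℂ → ℂ} (hF : IntegrableOn F (disk R)) :
    IntegrableOn (fun p : ℝ × ℝ => p.1 • F (circleMap 0 p.1 p.2)) (polarRect R) := by
  have h := (integrableOn_polar ((integrable_indicator_iff measurableSet_closedBall).2 hF)).mono_set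
    (polarRect_subset R)
  refine h.congr_fun (fun p hp => ?_) (measurableSet_polarRect R)
  have : circleMap 0 p.1 p.2 ∈ Metric.closedBall (0 : ℂ) R :=
    (circleMap_zero_mem_disk hp.1.1.le _).2 hp.1.2
  simp only [indicator_of_mem this]

lemma integral_disk_eq_polarRect (R : ℝ) (F : ℂ → ℂ) :
    ∫ ζ in disk R, F ζ = ∫ p in polarRect R, p.1 • F (circleMap 0 p.1 p.2) := by
  rw [← integral_indicator (show MeasurableSet (disk R) from measurableSet_closedBall),
    ← Complex.integral_comp_polarCoord_symm, polarCoord_target,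
    ← integral_indicator (measurableSet_Ioi.prod measurableSet_Ioo),
    ← integral_indicator (measurableSet_polarRect R)]
  congr 1
  funext p
  by_cases hp : p ∈ Ioi (0 : ℝ) ×ˢ Ioo (-Real.pi) Real.pi
  · rw [indicator_of_mem hp, polarCoord_symm_eq_circleMap]
    have hp0 : (0 : ℝ) < p.1 := hp.1
    by_cases hR : p.1 ≤ R
    · rw [indicator_of_mem ((circleMap_zero_mem_disk hp0.le _).2 hR),
        indicator_of_mem (show p ∈ polarRect R from ⟨⟨hp0, hR⟩, hp.2⟩)]
    · rw [indicator_of_notMem (fun h => hR ((circleMap_zero_mem_disk hp0.le _).1 h)),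
        indicator_of_notMem (fun h : p ∈ polarRect R => hR h.1.2), smul_zero]
  · rw [indicator_of_notMem hp, indicator_of_notMem (fun h => hp (polarRect_subset R h))]

lemma integral_circleMap_eq (F : ℂ → ℂ) (r : ℝ) :
    ∫ θ in Ioo (-Real.pi) Real.pi, F (circleMap 0 r θ) =
      (2 * Real.pi) • Real.circleAverage F 0 r := by
  rw [← integral_Ioc_eq_integral_Ioo,
    ← intervalIntegral.integral_of_le (by linarith [Real.pi_pos]), Real.circleAverage,
    smul_inv_smul₀ (by positivity)]
  have h : (fun θ => F (circleMap 0 r θ)).Periodic (2 * Real.pi) := fun x => by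
    simp [periodic_circleMap 0 r x]
  have := h.intervalIntegral_add_eq (-Real.pi) 0
  rw [show -Real.pi + 2 * Real.pi = Real.pi by ring, zero_add] at this
  exact this

/-- Integration over the disk by means of a primitive of `r ↦ 2 r · (average over |ζ| = r)`. -/
lemma integral_disk_of_circleAverage {R : ℝ} (hR : 0 ≤ R) {F : ℂ → ℂ} (hF : IntegrableOn F (disk R))
    {Φ : ℝ → ℂ} {S : Set ℝ} (hS : S.Countable) (hΦ : ContinuousOn Φ (Icc 0 R))
    (hd : ∀ r ∈ Ioo 0 R \ S, HasDerivAt Φ (2 * r * Real.circleAverage F 0 r) r) :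
    ∫ ζ in disk R, F ζ = Real.pi * (Φ R - Φ 0) := by
  have h := integrableOn_polarRect hF
  have e : ∀ r : ℝ, ∫ θ in Ioo (-Real.pi) Real.pi, r • F (circleMap 0 r θ) =
      Real.pi * (2 * r * Real.circleAverage F 0 r) := fun r => by
    rw [integral_smul, integral_circleMap_eq]
    simp only [Complex.real_smul]; push_cast; ring
  -- Fubini on the polar rectangle supplies the integrability of `Φ'`, so `Φ` only has to be
  -- continuous, and differentiable off a countable set.
  have hi : IntervalIntegrable (fun r : ℝ => 2 * r * Real.circleAverage F 0 r) volume 0 R := by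
    rw [intervalIntegrable_iff_integrableOn_Ioc_of_le hR]
    rw [IntegrableOn, polarRect, Measure.volume_eq_prod, ← Measure.prod_restrict] at h
    have h2 := (h.integral_prod_left).const_mul ((Real.pi : ℂ)⁻¹)
    refine h2.congr (Filter.Eventually.of_forall fun r => ?_)
    simp only [e]
    rw [inv_mul_cancel_left₀ (by simp [Real.pi_ne_zero])]
  rw [integral_disk_eq_polarRect, polarRect, Measure.volume_eq_prod, setIntegral_prod _ h]
  simp only [e]
  rw [integral_const_mul, ← intervalIntegral.integral_of_le hR,
    integral_eq_of_hasDerivAt_off_countable_of_le Φ _ hR hS hΦ hd hi]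

/-! ### Circle averages of Cauchy kernels -/

lemma circleAverage_conj (F : ℂ → ℂ) (r : ℝ) :
    Real.circleAverage (fun ζ => conj (F ζ)) 0 r = conj (Real.circleAverage F 0 r) := by
  simp only [Real.circleAverage, Complex.real_smul, map_mul, Complex.conj_ofReal]
  rw [intervalIntegral.integral_of_le (by positivity), intervalIntegral.integral_of_le (by positivity),
    integral_conj]

/-- This makes conjugation a rational function on each circle, so that averages involving `ζ̄` fall
under the mean value property and Cauchy's formula. -/
lemma conj_eq_of_mem_sphere {r : ℝ} (hr : 0 < r) {ζ : ℂ} (h : ζ ∈ Metric.sphere (0 : ℂ) |r|) :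
    ζ ≠ 0 ∧ conj ζ = (r : ℂ) ^ 2 / ζ := by
  rw [mem_sphere_zero_iff_norm, abs_of_pos hr] at h
  have h0 : ζ ≠ 0 := by rw [← norm_pos_iff, h]; exact hr
  refine ⟨h0, ?_⟩
  rw [eq_div_iff h0, mul_comm, Complex.mul_conj, Complex.normSq_eq_norm_sq, h]
  push_cast; rfl

/-- The circle average of `h(ζ) / (ζ̄ - w̄)` with `h` holomorphic, for `w` inside the circle. -/
lemma circleAverage_div_conj_sub_of_lt {r : ℝ} {w : ℂ} (hw : ‖w‖ < r) {h : ℂ → ℂ}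
    (hh : DifferentiableOn ℂ h (Metric.closedBall 0 r)) :
    Real.circleAverage (fun ζ => h ζ / (conj ζ - conj w)) 0 r = 0 := by
  have hr : 0 < r := (norm_nonneg w).trans_lt hw
  have hne : ∀ ζ ∈ Metric.closedBall (0 : ℂ) r, (r : ℂ) ^ 2 - conj w * ζ ≠ 0 := fun ζ hζ h0 => by
    rw [mem_closedBall_zero_iff] at hζ
    have := congrArg norm (sub_eq_zero.1 h0)
    rw [norm_mul, norm_pow, Complex.norm_real, Real.norm_of_nonneg hr.le, RCLike.norm_conj] at this
    nlinarith [norm_nonneg w, norm_nonneg ζ]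
  have hd : DifferentiableOn ℂ (fun ζ => ζ * h ζ / ((r : ℂ) ^ 2 - conj w * ζ))
      (Metric.closedBall 0 r) := by
    refine DifferentiableOn.div (differentiableOn_id.mul hh) ?_ hne
    fun_prop
  -- After `ζ̄ = r²/ζ` the integrand is holomorphic on the closed disk and contains the factor `ζ`,
  -- so its mean value, taken at `0`, vanishes.
  rw [Real.circleAverage_congr_sphere
    (f₂ := fun ζ => ζ * h ζ / ((r : ℂ) ^ 2 - conj w * ζ)) (fun ζ hζ => ?_)]
  · rw [DiffContOnCl.circleAverage]
    · simp
    · rw [abs_of_pos hr]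
      exact (hd.mono Metric.closure_ball_subset_closedBall).diffContOnCl
  · obtain ⟨h0, hc⟩ := conj_eq_of_mem_sphere hr hζ
    rw [mem_sphere_zero_iff_norm, abs_of_pos hr] at hζ
    have := hne ζ (by rw [mem_closedBall_zero_iff, hζ])
    simp only [hc]
    have e : (r : ℂ) ^ 2 / ζ - conj w = ((r : ℂ) ^ 2 - conj w * ζ) / ζ := by field_simp
    rw [e, div_div_eq_mul_div, mul_comm]

/-- The circle average of `h(ζ) / (ζ̄ - w̄)` with `h` holomorphic, for `w` outside the circle. -/
lemma circleAverage_div_conj_sub_of_gt {r : ℝ} (hr : 0 < r) {w : ℂ} (hw : r < ‖w‖) {h : ℂ → ℂ}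
    (hh : DifferentiableOn ℂ h (Metric.closedBall 0 r)) :
    Real.circleAverage (fun ζ => h ζ / (conj ζ - conj w)) 0 r =
      -(h ((r : ℂ) ^ 2 / conj w) / conj w) := by
  have hw0 : conj w ≠ 0 := by
    rw [← norm_pos_iff, RCLike.norm_conj]; exact hr.trans hw
  have hc : (r : ℂ) ^ 2 / conj w ∈ Metric.ball (0 : ℂ) |r| := by
    rw [mem_ball_zero_iff, abs_of_pos hr, norm_div, norm_pow, Complex.norm_real,
      Real.norm_of_nonneg hr.le, RCLike.norm_conj, div_lt_iff₀ (hr.trans hw)]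
    nlinarith
  -- Now the pole `r²/w̄` lies inside the circle, and the average is Cauchy's formula at that point.
  have hd : DiffContOnCl ℂ (fun ζ => -(h ζ / conj w)) (Metric.ball 0 |r|) := by
    rw [abs_of_pos hr]
    exact ((hh.mono Metric.closure_ball_subset_closedBall).div_const _).neg.diffContOnCl
  rw [← hd.circleAverage_smul_div hc]
  refine Real.circleAverage_congr_sphere fun ζ hζ => ?_
  obtain ⟨h0, hc'⟩ := conj_eq_of_mem_sphere hr hζ
  have hne : ζ - (r : ℂ) ^ 2 / conj w ≠ 0 := fun h0 => by
    rw [mem_sphere_zero_iff_norm, sub_eq_zero.1 h0] at hζ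
    rw [mem_ball_zero_iff, hζ] at hc
    exact lt_irrefl _ hc
  simp only [hc', sub_zero, smul_eq_mul]
  have e : (r : ℂ) ^ 2 / ζ - conj w = -(conj w * (ζ - (r : ℂ) ^ 2 / conj w) / ζ) := by
    field_simp; ring
  rw [e]
  field_simp

/-! ### Cauchy transforms of elementary functions -/

lemma measurableSet_disk (R : ℝ) : MeasurableSet (disk R) := measurableSet_closedBall

lemma exists_norm_le_of_continuousOn {R : ℝ} {g : ℂ → ℂ} (hg : ContinuousOn g (disk R)) :
    ∃ C, 0 ≤ C ∧ ∀ ζ ∈ disk R, ‖g ζ‖ ≤ C := by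
  obtain ⟨C, hC⟩ := (isCompact_closedBall (0 : ℂ) R).exists_bound_of_continuousOn hg
  exact ⟨max C 0, le_max_right _ _, fun ζ hζ => (hC ζ hζ).trans (le_max_left _ _)⟩

lemma integrableOn_div_sub {R : ℝ} {g : ℂ → ℂ} (hg : ContinuousOn g (disk R)) (z : ℂ) :
    IntegrableOn (fun ζ => g ζ / (ζ - z)) (disk R) := by
  obtain ⟨C, -, hC⟩ := exists_norm_le_of_continuousOn hg
  refine integrableOn_of_norm_le_inv (z := z) (C := C) ?_ fun ζ hζ => ?_
  · simp only [div_eq_mul_inv]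
    exact (hg.aestronglyMeasurable (measurableSet_disk R)).mul
      (Measurable.aestronglyMeasurable (by fun_prop))
  · rw [norm_div, div_eq_mul_inv]
    gcongr
    exact hC ζ hζ

lemma integrableOn_div_conj_sub {R : ℝ} {g : ℂ → ℂ} (hg : ContinuousOn g (disk R)) (z : ℂ) :
    IntegrableOn (fun ζ => g ζ / (conj ζ - conj z)) (disk R) := by
  have := (integrableOn_div_sub (g := fun ζ => conj (g ζ))
    (Complex.continuous_conj.comp_continuousOn hg) z)
  simpa [IntegrableOn] using Complex.conjLIE.toContinuousLinearEquiv.toContinuousLinearMap.integrable_comp this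

/-- `∫ h(ζ) / (ζ̄ - z̄)` for an entire function `h` with primitive `H`. -/
lemma integral_div_conj_sub {R : ℝ} (hR : 0 ≤ R) {h H : ℂ → ℂ} (hH : ∀ ζ, HasDerivAt H (h ζ) ζ)
    (hh : Differentiable ℂ h) {z : ℂ} (hz : z ∈ disk R) :
    ∫ ζ in disk R, h ζ / (conj ζ - conj z) = -(Real.pi * (H z - H 0)) := by
  have hzR : ‖z‖ ≤ R := by simpa [disk] using hz
  -- Circles with `r > |z|` contribute nothing, hence the truncation at `|z|`, where the argument
  -- equals `z`. For `z = 0` the convention `x / 0 = 0` still gives the right endpoint value.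
  set Φ : ℝ → ℂ := fun r => -H (((min r ‖z‖ : ℝ) : ℂ) ^ 2 / conj z) with hΦ
  have hHc : Continuous H := continuous_iff_continuousAt.2 fun ζ => (hH ζ).continuousAt
  have hc : Continuous Φ := by
    refine (hHc.comp ?_).neg
    fun_prop
  rw [integral_disk_of_circleAverage hR (integrableOn_div_conj_sub hh.continuous.continuousOn z)
    (countable_singleton ‖z‖) hc.continuousOn]
  · have e : Φ R = -H z := by
      simp only [hΦ, min_eq_right hzR]
      by_cases h0 : z = 0
      · simp [h0]
      · congr 2
        rw [div_eq_iff (by simpa using h0), Complex.mul_conj, Complex.normSq_eq_norm_sq]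
        push_cast; rfl
    have e0 : Φ 0 = -H 0 := by simp [hΦ]
    rw [e, e0]; ring
  · rintro r ⟨⟨hr0, hrR⟩, hr⟩
    rcases lt_or_gt_of_ne (show r ≠ ‖z‖ from hr) with hlt | hgt
    · rw [circleAverage_div_conj_sub_of_gt hr0 hlt hh.differentiableOn]
      have h1 : HasDerivAt (fun s : ℝ => (s : ℂ) ^ 2 / conj z) (2 * (r : ℂ) / conj z) r := by
        have := ((Complex.ofRealCLM.hasDerivAt (x := r)).pow 2).div_const (conj z)
        simpa using this
      have h2 := ((hH ((r : ℂ) ^ 2 / conj z)).scomp r h1).neg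
      have h3 : Φ =ᶠ[nhds r] fun s => -(H ∘ fun s : ℝ => (s : ℂ) ^ 2 / conj z) s := by
        filter_upwards [gt_mem_nhds hlt] with s hs
        simp only [hΦ, min_eq_left hs.le, Function.comp_apply]
      refine (h2.congr_of_eventuallyEq h3).congr_deriv ?_
      simp only [smul_eq_mul]; ring
    · rw [circleAverage_div_conj_sub_of_lt hgt hh.differentiableOn, mul_zero]
      have h3 : Φ =ᶠ[nhds r] fun _ => -H (((‖z‖ : ℝ) : ℂ) ^ 2 / conj z) := by
        filter_upwards [lt_mem_nhds hgt] with s hs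
        simp only [hΦ, min_eq_right hs.le]
      exact (hasDerivAt_const r _).congr_of_eventuallyEq h3

lemma integral_conj_div_sub {R : ℝ} (hR : 0 ≤ R) {h H : ℂ → ℂ} (hH : ∀ ζ, HasDerivAt H (h ζ) ζ)
    (hh : Differentiable ℂ h) {z : ℂ} (hz : z ∈ disk R) :
    ∫ ζ in disk R, conj (h ζ) / (ζ - z) = -(Real.pi * conj (H z - H 0)) := by
  have := congrArg conj (integral_div_conj_sub hR hH hh hz)
  rw [← integral_conj] at this
  simpa using this

lemma hasDerivAt_sub_pow_div (w : ℂ) (n : ℕ) (ζ : ℂ) :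
    HasDerivAt (fun ζ => (ζ - w) ^ (n + 1) / ((n : ℂ) + 1)) ((ζ - w) ^ n) ζ := by
  have h := (((hasDerivAt_id ζ).sub_const w).pow (n + 1)).div_const ((n : ℂ) + 1)
  refine h.congr_deriv ?_
  have : (n : ℂ) + 1 ≠ 0 := by exact_mod_cast n.succ_ne_zero
  simp; field_simp

lemma integral_sub_pow_div_conj_sub {R : ℝ} (hR : 0 ≤ R) (w : ℂ) (n : ℕ) {z : ℂ} (hz : z ∈ disk R) :
    ∫ ζ in disk R, (ζ - w) ^ n / (conj ζ - conj z) =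
      -(Real.pi * ((z - w) ^ (n + 1) - (-w) ^ (n + 1)) / ((n : ℂ) + 1)) := by
  rw [integral_div_conj_sub hR (hasDerivAt_sub_pow_div w n) (by fun_prop) hz]
  simp only [zero_sub]; ring

lemma integral_conj_sub_pow_div_sub {R : ℝ} (hR : 0 ≤ R) (w : ℂ) (n : ℕ) {z : ℂ} (hz : z ∈ disk R) :
    ∫ ζ in disk R, (conj ζ - conj w) ^ n / (ζ - z) =
      -(Real.pi * ((conj z - conj w) ^ (n + 1) - (-conj w) ^ (n + 1)) / ((n : ℂ) + 1)) := by
  have := integral_conj_div_sub hR (hasDerivAt_sub_pow_div w n) (by fun_prop) hz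
  simp only [map_pow, map_sub, map_div₀, map_add, map_natCast, map_one, zero_sub, map_neg] at this
  rw [this]; ring

lemma circleAverage_conj_pow_mul_pow {r : ℝ} (hr : 0 < r) (m n : ℕ) (hmn : m < n) :
    Real.circleAverage (fun ζ => conj ζ ^ m * ζ ^ n) 0 r = 0 := by
  rw [Real.circleAverage_congr_sphere (f₂ := fun ζ => (r : ℂ) ^ (2 * m) * ζ ^ (n - m))
    fun ζ hζ => ?_]
  · rw [DiffContOnCl.circleAverage (Differentiable.diffContOnCl (by fun_prop)),
      zero_pow (by omega), mul_zero]
  · obtain ⟨h0, hc⟩ := conj_eq_of_mem_sphere hr hζ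
    simp only [hc, div_pow]
    obtain ⟨k, rfl⟩ := Nat.exists_eq_add_of_lt hmn
    rw [show m + k + 1 - m = k + 1 by omega]
    field_simp
    ring

lemma integral_conj_pow_mul_pow {R : ℝ} (hR : 0 ≤ R) (m n : ℕ) :
    ∫ ζ in disk R, conj ζ ^ m * ζ ^ n =
      if m = n then Real.pi * (R : ℂ) ^ (2 * (m + 1)) / ((m : ℂ) + 1) else 0 := by
  have hi : IntegrableOn (fun ζ : ℂ => conj ζ ^ m * ζ ^ n) (disk R) :=
    (Continuous.continuousOn (by fun_prop)).integrableOn_compact (isCompact_closedBall _ _)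
  split_ifs with hmn
  · subst hmn
    have hm : (m : ℂ) + 1 ≠ 0 := by exact_mod_cast m.succ_ne_zero
    rw [integral_disk_of_circleAverage (Φ := fun r : ℝ => (r : ℂ) ^ (2 * (m + 1)) / ((m : ℂ) + 1))
      hR hi countable_empty (by fun_prop)]
    · simp; ring
    · rintro r ⟨⟨hr, -⟩, -⟩
      rw [Real.circleAverage_const_on_circle (a := (r : ℂ) ^ (2 * m)) fun ζ hζ => ?_]
      · have h := ((Complex.ofRealCLM.hasDerivAt (x := r)).pow (2 * (m + 1))).div_const ((m : ℂ) + 1)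
        refine h.congr_deriv ?_
        rw [show 2 * (m + 1) - 1 = 2 * m + 1 by omega]
        simp; field_simp; ring
      · obtain ⟨h0, hc⟩ := conj_eq_of_mem_sphere hr hζ
        rw [hc, div_pow, ← pow_mul, div_mul_cancel₀ _ (pow_ne_zero _ h0)]
  · rw [integral_disk_of_circleAverage (Φ := fun _ => 0) hR hi countable_empty (by fun_prop)]
    · simp
    · rintro r ⟨⟨hr, -⟩, -⟩
      suffices h : Real.circleAverage (fun ζ : ℂ => conj ζ ^ m * ζ ^ n) 0 r = 0 by
        rw [h, mul_zero]; exact hasDerivAt_const _ _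
      rcases lt_or_gt_of_ne hmn with h | h
      · exact circleAverage_conj_pow_mul_pow hr m n h
      · have := circleAverage_conj (fun ζ => conj ζ ^ n * ζ ^ m) r
        rw [circleAverage_conj_pow_mul_pow hr n m h, map_zero] at this
        rw [← this]
        congr 1; funext ζ; simp; ring

lemma ae_ne (R : ℝ) (z : ℂ) : ∀ᵐ ζ ∂volume.restrict (disk R), ζ ≠ z :=
  ae_restrict_of_ae (Measure.ae_ne volume z)

/-- From `(ζ - w)/(ζ - z) = (z - w)/(ζ - z) + 1`. It drives the recursions on the power of `ζ` or `ζ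
- w` below. -/
lemma integral_sub_mul_div_sub {R : ℝ} {g : ℂ → ℂ} (w z : ℂ) (hg : IntegrableOn g (disk R))
    (hg' : IntegrableOn (fun ζ => g ζ / (ζ - z)) (disk R)) :
    ∫ ζ in disk R, (ζ - w) * g ζ / (ζ - z) =
      (z - w) * (∫ ζ in disk R, g ζ / (ζ - z)) + ∫ ζ in disk R, g ζ := by
  rw [← integral_const_mul, ← integral_add (hg'.const_mul _) hg]
  refine integral_congr_ae ?_
  filter_upwards [ae_ne R z] with ζ hζ
  have := sub_ne_zero.2 hζ
  field_simp
  ring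

/-- In the recursion on `n` the extra area integral is nonzero only at `n = m`. There it creates the
term in `R^{2(m+1)}`, which later steps merely multiply by `z`. -/
lemma integral_conj_pow_mul_pow_div_sub {R : ℝ} (hR : 0 ≤ R) (m n : ℕ) {z : ℂ} (hz : z ∈ disk R) :
    ∫ ζ in disk R, conj ζ ^ m * ζ ^ n / (ζ - z) =
      -(Real.pi / ((m : ℂ) + 1) * (conj z ^ (m + 1) * z ^ n -
        if m + 1 ≤ n then (R : ℂ) ^ (2 * (m + 1)) * z ^ (n - (m + 1)) else 0)) := by
  induction n with
  | zero =>
    have := integral_conj_sub_pow_div_sub hR 0 m hz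
    simp only [map_zero, sub_zero, neg_zero] at this
    simp [this]; ring
  | succ n ih =>
    have hc : Continuous fun ζ : ℂ => conj ζ ^ m * ζ ^ n := by fun_prop
    have h := integral_sub_mul_div_sub 0 z
      (hc.continuousOn.integrableOn_compact (isCompact_closedBall (0 : ℂ) R))
      (integrableOn_div_sub hc.continuousOn z)
    have e : ∀ ζ : ℂ, (ζ - 0) * (conj ζ ^ m * ζ ^ n) = conj ζ ^ m * ζ ^ (n + 1) := fun ζ => by ring
    simp only [e] at h
    rw [h, ih, integral_conj_pow_mul_pow hR]
    rcases lt_trichotomy m n with hmn | rfl | hmn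
    · rw [if_pos (by omega), if_neg (by omega), if_pos (by omega),
        show n + 1 - (m + 1) = n - (m + 1) + 1 by omega]
      ring
    · rw [if_neg (by omega), if_pos rfl, if_pos le_rfl]
      simp; ring
    · rw [if_neg (by omega), if_neg (by omega), if_neg (by omega)]
      ring

/-! ### The kernels `C₁`, `C₂` and the logarithm -/

/-- `C₂` arises from the Cauchy transform of `(ζ̄ - b̄)^l (ζ - b)^n`. -/
lemma integral_conj_sub_pow_mul_sub_pow_div_sub {R : ℝ} (hR : 0 ≤ R) (l n : ℕ) (b : ℂ) {z : ℂ}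
    (hz : z ∈ disk R) :
    ∫ ζ in disk R, (conj ζ - conj b) ^ l * (ζ - b) ^ n / (ζ - z) =
      Real.pi * (-1 / ((l + 1 : ℕ) : ℂ) * (conj z - conj b) ^ (l + 1) * (z - b) ^ n
        + 1 / ((l + 1 : ℕ) : ℂ) * C₂ R z b (l + 1) (n + 1)) := by
  have e : ∀ ζ : ℂ, (conj ζ - conj b) ^ l * (ζ - b) ^ n / (ζ - z) =
      ∑ p ∈ Finset.range (l + 1), ∑ q ∈ Finset.range (n + 1),
        ((-conj b) ^ (l - p) * (-b) ^ (n - q) * (l.choose p : ℂ) * (n.choose q : ℂ)) *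
          (conj ζ ^ p * ζ ^ q / (ζ - z)) := fun ζ => by
    rw [sub_eq_add_neg (conj ζ), sub_eq_add_neg ζ b, add_pow, add_pow, Finset.sum_mul_sum,
      Finset.sum_div]
    refine Finset.sum_congr rfl fun p _ => ?_
    rw [Finset.sum_div]
    refine Finset.sum_congr rfl fun q _ => ?_
    ring
  have hi : ∀ p q : ℕ, IntegrableOn (fun ζ : ℂ =>
      ((-conj b) ^ (l - p) * (-b) ^ (n - q) * (l.choose p : ℂ) * (n.choose q : ℂ)) *
          (conj ζ ^ p * ζ ^ q / (ζ - z))) (disk R) := fun p q =>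
    Integrable.const_mul (integrableOn_div_sub (Continuous.continuousOn (by fun_prop)) z) _
  simp only [e]
  rw [integral_finsetSum _ fun p _ => integrable_finsetSum _ fun q _ => hi p q]
  have hl : ((l + 1 : ℕ) : ℂ) ≠ 0 := by exact_mod_cast l.succ_ne_zero
  have hz' : (conj z - conj b) ^ (l + 1) * (z - b) ^ n =
      ∑ p ∈ Finset.range (l + 2), ∑ q ∈ Finset.range (n + 1),
        ((l + 1).choose p : ℂ) * (n.choose q : ℂ) * (-conj b) ^ (l + 1 - p) * (-b) ^ (n - q) *
          (conj z ^ p * z ^ q) := by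
    rw [sub_eq_add_neg (conj z), sub_eq_add_neg z b, add_pow, add_pow, Finset.sum_mul_sum]
    exact Finset.sum_congr rfl fun p _ => Finset.sum_congr rfl fun q _ => by ring
  have key : -1 / ((l + 1 : ℕ) : ℂ) * (conj z - conj b) ^ (l + 1) * (z - b) ^ n
        + 1 / ((l + 1 : ℕ) : ℂ) * C₂ R z b (l + 1) (n + 1) =
      ∑ p ∈ Finset.range (l + 2), ∑ q ∈ Finset.range (n + 1),
        -(((l + 1).choose p : ℂ) * (n.choose q : ℂ) * (-conj b) ^ (l + 1 - p) * (-b) ^ (n - q) *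
          (conj z ^ p * z ^ q - if p ≤ q then (R : ℂ) ^ (2 * p) * z ^ (q - p) else 0) /
            ((l + 1 : ℕ) : ℂ)) := by
    rw [mul_assoc, hz', C₂]
    simp only [Nat.add_sub_cancel]
    rw [Finset.mul_sum, Finset.mul_sum, ← Finset.sum_add_distrib]
    refine Finset.sum_congr rfl fun p _ => ?_
    rw [Finset.mul_sum, Finset.mul_sum, ← Finset.sum_add_distrib]
    refine Finset.sum_congr rfl fun q _ => ?_
    split_ifs <;> ring
  -- The row `p = 0` vanishes because `0 ≤ q` always holds there; the rows `p + 1` match the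
  -- integrals with `ζ̄^p`, and the absorption identity for binomials converts `1/(p+1)` into
  -- `1/(l+1)`.
  rw [key, Finset.sum_range_succ' _ (l + 1), mul_add]
  have h0 : ∑ q ∈ Finset.range (n + 1),
        -(((l + 1).choose 0 : ℂ) * (n.choose q : ℂ) * (-conj b) ^ (l + 1 - 0) * (-b) ^ (n - q) *
          (conj z ^ 0 * z ^ q - if 0 ≤ q then (R : ℂ) ^ (2 * 0) * z ^ (q - 0) else 0) /
            ((l + 1 : ℕ) : ℂ)) = 0 := Finset.sum_eq_zero fun q _ => by simp
  rw [h0, mul_zero, add_zero, Finset.mul_sum]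
  refine Finset.sum_congr rfl fun p _ => ?_
  rw [integral_finsetSum _ fun q _ => hi p q, Finset.mul_sum]
  refine Finset.sum_congr rfl fun q _ => ?_
  rw [integral_const_mul, integral_conj_pow_mul_pow_div_sub hR p q hz]
  have hp : (p : ℂ) + 1 ≠ 0 := by exact_mod_cast p.succ_ne_zero
  have hch : ((l + 1).choose (p + 1) : ℂ) * ((p : ℂ) + 1) = ((l + 1 : ℕ) : ℂ) * (l.choose p : ℂ) := by
    exact_mod_cast (Nat.add_one_mul_choose_eq l p).symm
  have hch' : ((l + 1).choose (p + 1) : ℂ) = ((l + 1 : ℕ) : ℂ) * (l.choose p : ℂ) / ((p : ℂ) + 1) := by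
    rw [← hch]; field_simp
  rw [hch', Nat.add_sub_add_right]
  field_simp

/-! ### The logarithmic kernel and the recursion for `C₁` -/

lemma integrableOn_inv_mul_inv {R : ℝ} {z w : ℂ} (hzw : z ≠ w) :
    IntegrableOn (fun ζ => (ζ - z)⁻¹ / (conj ζ - conj w)) (disk R) := by
  have hm : Measurable fun ζ : ℂ => (ζ - z)⁻¹ / (conj ζ - conj w) := by
    have : Measurable (fun ζ : ℂ => conj ζ) := Complex.continuous_conj.measurable
    fun_prop
  refine Integrable.mono' (((integrableOn_norm_sub_inv z R).add
    (integrableOn_norm_sub_inv w R)).const_mul ‖z - w‖⁻¹) hm.aestronglyMeasurable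
    (Filter.Eventually.of_forall fun ζ => ?_)
  simp only [Pi.add_apply]
  rw [norm_div, norm_inv, ← map_sub, RCLike.norm_conj, div_eq_mul_inv]
  have h0 : 0 < ‖z - w‖ := norm_pos_iff.2 (sub_ne_zero.2 hzw)
  rcases (norm_nonneg (ζ - z)).eq_or_lt with h1 | h1
  · rw [← h1]; simp; positivity
  rcases (norm_nonneg (ζ - w)).eq_or_lt with h2 | h2
  · rw [← h2]; simp; positivity
  -- Dividing this by the product of the two distances separates the singularities into a sum of
  -- simple ones.
  have h3 : ‖z - w‖ ≤ ‖ζ - z‖ + ‖ζ - w‖ := by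
    calc ‖z - w‖ = ‖(ζ - w) - (ζ - z)‖ := by congr 1; ring
      _ ≤ _ := by rw [add_comm]; exact norm_sub_le _ _
  rw [le_inv_mul_iff₀ h0, ← mul_assoc, ← div_eq_mul_inv, div_le_iff₀ h2, ← div_eq_mul_inv,
    div_le_iff₀ h1]
  calc ‖z - w‖ ≤ ‖ζ - z‖ + ‖ζ - w‖ := h3
    _ = _ := by field_simp; ring

lemma one_sub_mem_slitPlane {c : ℂ} (hc : ‖c‖ < 1) : 1 - c ∈ Complex.slitPlane := by
  left
  have := (Complex.abs_re_le_norm c).trans_lt hc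
  rw [abs_lt] at this
  simp; linarith

lemma real_sub_re_pos {a : ℝ} {c : ℂ} (hc : ‖c‖ < a) : 0 < ((a : ℂ) - c).re := by
  have := (Complex.abs_re_le_norm c).trans_lt hc
  rw [abs_lt] at this
  simp; linarith

/-- Both arguments lie in `(-π/2, π/2)`, so their sum stays inside the principal range. -/
lemma log_mul_of_re_pos {u v : ℂ} (hu : 0 < u.re) (hv : 0 < v.re) :
    Complex.log (u * v) = Complex.log u + Complex.log v := by
  have h1 := abs_lt.1 (Complex.abs_arg_lt_pi_div_two_iff.2 (Or.inl hu))
  have h2 := abs_lt.1 (Complex.abs_arg_lt_pi_div_two_iff.2 (Or.inl hv))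
  refine Complex.log_mul (fun h => by simp [h] at hu) (fun h => by simp [h] at hv) ⟨?_, ?_⟩ <;>
    linarith [h1.1, h1.2, h2.1, h2.2]

/-- Piecewise primitive of the circle averages of `1 / ((ζ - z) (ζ̄ - w̄))` for `|z| < |w|`. -/
lemma integral_inv_mul_inv_of_lt {R : ℝ} {z w : ℂ} (hw : w ∈ disk R) (hzw : ‖z‖ < ‖w‖) :
    ∫ ζ in disk R, (ζ - z)⁻¹ / (conj ζ - conj w) =
      Real.pi * Complex.log (((R : ℂ) ^ 2 - z * conj w) / ((‖z - w‖ ^ 2 : ℝ) : ℂ)) := by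
  have hwR : ‖w‖ ≤ R := by simpa [disk] using hw
  have hw0 : 0 < ‖w‖ := (norm_nonneg z).trans_lt hzw
  have hR : 0 < R := hw0.trans_le hwR
  have hne : z ≠ w := fun h => by simp [h] at hzw
  set c := z * conj w with hc
  have hcn : ‖c‖ = ‖z‖ * ‖w‖ := by rw [hc, norm_mul, RCLike.norm_conj]
  have hA : ∀ r : ℝ, 0 ≤ r → r ≤ ‖z‖ → ‖(r : ℂ) ^ 2 / c‖ < 1 := fun r hr hrz => by
    rcases hr.eq_or_lt with rfl | hr
    · simp
    have hz0 : 0 < ‖z‖ := hr.trans_le hrz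
    rw [norm_div, hcn, div_lt_one (by positivity), norm_pow, Complex.norm_real,
      Real.norm_of_nonneg hr.le]
    nlinarith
  have hB : ∀ r : ℝ, ‖w‖ ≤ r → ‖c‖ < r ^ 2 := fun r hr => by
    rw [hcn]; nlinarith [norm_nonneg z]
  have hB' : ∀ r : ℝ, ‖w‖ ≤ r → 0 < ((r : ℂ) ^ 2 - c).re := fun r hr => by
    have := real_sub_re_pos (hB r hr); simpa using this
  -- Three regimes: the first logarithm varies for `r < |z|`, both are frozen on the annulus `|z| <
  -- r < |w|` where the averages vanish, and the second varies for `r > |w|`.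
  set Φ : ℝ → ℂ := fun r => -Complex.log (1 - ((min r ‖z‖ : ℝ) : ℂ) ^ 2 / c) +
    Complex.log (((max r ‖w‖ : ℝ) : ℂ) ^ 2 - c) with hΦ
  have hΦc : ContinuousOn Φ (Icc 0 R) := by
    refine (ContinuousOn.clog (by fun_prop) fun r hr => ?_).neg.add
      (ContinuousOn.clog (by fun_prop) fun r hr => ?_)
    · exact one_sub_mem_slitPlane (hA _ (le_min hr.1 (norm_nonneg _)) (min_le_right _ _))
    · exact Or.inl (hB' _ (le_max_right _ _))
  rw [integral_disk_of_circleAverage hR.le (integrableOn_inv_mul_inv hne)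
    (S := {‖z‖, ‖w‖}) (by simp) hΦc]
  · congr 1
    have e1 : Φ 0 = Complex.log (((‖w‖ : ℝ) : ℂ) ^ 2 - c) := by
      simp [hΦ]
    have e2 : Φ R = -Complex.log (1 - ((‖z‖ : ℝ) : ℂ) ^ 2 / c) + Complex.log ((R : ℂ) ^ 2 - c) := by
      simp only [hΦ, max_eq_left hwR, min_eq_right (hzw.le.trans hwR)]
    have hre : 0 < (1 - ((‖z‖ : ℝ) : ℂ) ^ 2 / c).re := by
      have := real_sub_re_pos (hA ‖z‖ (norm_nonneg _) le_rfl)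
      simpa using this
    have hd0 : 0 < ‖z - w‖ ^ 2 := by
      have := norm_pos_iff.2 (sub_ne_zero.2 hne)
      positivity
    -- The two frozen values multiply to `|z - w|²`, the denominator in the logarithm; division by
    -- zero being zero, this covers `z = 0`.
    have e3 : (1 - ((‖z‖ : ℝ) : ℂ) ^ 2 / c) * (((‖w‖ : ℝ) : ℂ) ^ 2 - c) =
        ((‖z - w‖ ^ 2 : ℝ) : ℂ) := by
      have n1 : ((‖z‖ : ℝ) : ℂ) ^ 2 = z * conj z := by
        rw [Complex.mul_conj, Complex.normSq_eq_norm_sq]; push_cast; rfl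
      have n2 : ((‖w‖ : ℝ) : ℂ) ^ 2 = w * conj w := by
        rw [Complex.mul_conj, Complex.normSq_eq_norm_sq]; push_cast; rfl
      have n3 : ((‖z - w‖ ^ 2 : ℝ) : ℂ) = (z - w) * (conj z - conj w) := by
        rw [← map_sub, Complex.mul_conj, Complex.normSq_eq_norm_sq]
      rw [n1, n2, n3, hc]
      have hcw : conj w ≠ 0 := by rw [← norm_pos_iff, RCLike.norm_conj]; exact hw0
      by_cases hz0 : z = 0
      · simp [hz0]
      · field_simp; ring
    have e4 : Complex.log (1 - ((‖z‖ : ℝ) : ℂ) ^ 2 / c) + Complex.log (((‖w‖ : ℝ) : ℂ) ^ 2 - c) =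
        Complex.log ((‖z - w‖ ^ 2 : ℝ) : ℂ) := by
      rw [← log_mul_of_re_pos hre (hB' _ le_rfl), e3]
    have e5 : Complex.log (((R : ℂ) ^ 2 - c) / ((‖z - w‖ ^ 2 : ℝ) : ℂ)) =
        Complex.log ((R : ℂ) ^ 2 - c) - Complex.log ((‖z - w‖ ^ 2 : ℝ) : ℂ) := by
      have hRc : (R : ℂ) ^ 2 - c ≠ 0 := fun h => by
        have := hB' R hwR
        rw [h] at this; simp at this
      rw [div_eq_mul_inv, mul_comm, ← Complex.ofReal_inv, Complex.log_ofReal_mul (inv_pos.2 hd0) hRc,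
        Real.log_inv, ← Complex.ofReal_log hd0.le]
      push_cast; ring
    rw [e1, e2, e5, ← e4]; ring
  · rintro r ⟨⟨hr0, hrR⟩, hr⟩
    simp only [mem_insert_iff, mem_singleton_iff, not_or] at hr
    have hsq : HasDerivAt (fun s : ℝ => (s : ℂ) ^ 2) (2 * (r : ℂ)) r := by
      refine ((Complex.ofRealCLM.hasDerivAt (x := r)).fun_pow 2).congr_deriv ?_
      simp
    rcases lt_or_gt_of_ne hr.1 with h1 | h1
    · have hdiff : DifferentiableOn ℂ (fun ζ : ℂ => (ζ - z)⁻¹) (Metric.closedBall 0 r) := by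
        refine DifferentiableOn.inv (by fun_prop) fun ζ hζ h0 => ?_
        rw [sub_eq_zero.1 h0, mem_closedBall_zero_iff] at hζ
        linarith
      rw [circleAverage_div_conj_sub_of_gt hr0 (h1.trans hzw) hdiff]
      have h3 : Φ =ᶠ[nhds r] fun s => -Complex.log (1 - (s : ℂ) ^ 2 / c) +
          Complex.log (((‖w‖ : ℝ) : ℂ) ^ 2 - c) := by
        filter_upwards [gt_mem_nhds h1] with s hs
        simp only [hΦ, min_eq_left hs.le, max_eq_right (hs.trans hzw).le]
      have hsl := one_sub_mem_slitPlane (hA r hr0.le h1.le)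
      refine ((((hsq.div_const c).const_sub 1).clog_real hsl).neg.add_const _
        |>.congr_of_eventuallyEq h3).congr_deriv ?_
      have hcw : conj w ≠ 0 := by rw [← norm_pos_iff, RCLike.norm_conj]; exact hw0
      have hz0 : z ≠ 0 := norm_pos_iff.1 (hr0.trans h1)
      have hs0 := Complex.slitPlane_ne_zero hsl
      have hc0 : c ≠ 0 := mul_ne_zero hz0 hcw
      have e1 : (1 : ℂ) - (r : ℂ) ^ 2 / c = (c - (r : ℂ) ^ 2) / c := by field_simp
      have e2 : (r : ℂ) ^ 2 / conj w - z = -((c - (r : ℂ) ^ 2) / conj w) := by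
        rw [hc]; field_simp; ring
      rw [e1] at hs0 ⊢
      rw [e2]
      have hs1 : c - (r : ℂ) ^ 2 ≠ 0 := fun h => hs0 (by rw [h, zero_div])
      field_simp
    · rcases lt_or_gt_of_ne hr.2 with h2 | h2
      · have hdiff : DifferentiableOn ℂ (fun ζ : ℂ => (ζ - w)⁻¹) (Metric.closedBall 0 r) := by
          refine DifferentiableOn.inv (by fun_prop) fun ζ hζ h0 => ?_
          rw [sub_eq_zero.1 h0, mem_closedBall_zero_iff] at hζ
          linarith
        -- Conjugation exchanges `z` and `w`, so that the holomorphic factor has its pole at `w`,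
        -- outside the circle.
        have h4 := circleAverage_conj (fun ζ => (ζ - w)⁻¹ / (conj ζ - conj z)) r
        rw [circleAverage_div_conj_sub_of_lt h1 hdiff, map_zero] at h4
        have h5 : Real.circleAverage (fun ζ : ℂ => (ζ - z)⁻¹ / (conj ζ - conj w)) 0 r = 0 := by
          rw [← h4]; congr 1; funext ζ; simp; ring
        rw [h5, mul_zero]
        have h3 : Φ =ᶠ[nhds r] fun s => Φ r := by
          filter_upwards [lt_mem_nhds h1, gt_mem_nhds h2] with s hs hs'
          simp only [hΦ, min_eq_right hs.le, max_eq_right hs'.le, min_eq_right h1.le,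
            max_eq_right h2.le]
        exact (hasDerivAt_const r _).congr_of_eventuallyEq h3
      · have hd : DifferentiableOn ℂ (fun ζ : ℂ => ((r : ℂ) ^ 2 - conj w * ζ)⁻¹)
            (Metric.closedBall 0 r) := by
          refine DifferentiableOn.inv (by fun_prop) fun ζ hζ h0 => ?_
          rw [mem_closedBall_zero_iff] at hζ
          have := congrArg norm (sub_eq_zero.1 h0)
          rw [norm_mul, norm_pow, Complex.norm_real, Real.norm_of_nonneg hr0.le,
            RCLike.norm_conj] at this
          nlinarith [norm_nonneg ζ]
        have h4 : Real.circleAverage (fun ζ : ℂ => (ζ - z)⁻¹ / (conj ζ - conj w)) 0 r =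
            ((r : ℂ) ^ 2 - conj w * z)⁻¹ := by
          have hz : z ∈ Metric.ball (0 : ℂ) |r| := by
            rw [mem_ball_zero_iff, abs_of_pos hr0]; exact h1
          have hd' : DiffContOnCl ℂ (fun ζ : ℂ => ((r : ℂ) ^ 2 - conj w * ζ)⁻¹)
              (Metric.ball 0 |r|) := by
            rw [abs_of_pos hr0]
            exact (hd.mono Metric.closure_ball_subset_closedBall).diffContOnCl
          rw [← hd'.circleAverage_smul_div hz]
          refine Real.circleAverage_congr_sphere fun ζ hζ => ?_
          obtain ⟨h0, hcj⟩ := conj_eq_of_mem_sphere hr0 hζ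
          have e : (r : ℂ) ^ 2 / ζ - conj w = ((r : ℂ) ^ 2 - conj w * ζ) / ζ := by field_simp
          simp only [hcj, sub_zero, smul_eq_mul]
          rw [e, div_div_eq_mul_div]
          ring
        rw [h4]
        have h3 : Φ =ᶠ[nhds r] fun s => -Complex.log (1 - ((‖z‖ : ℝ) : ℂ) ^ 2 / c) +
            Complex.log ((s : ℂ) ^ 2 - c) := by
          filter_upwards [lt_mem_nhds h1, lt_mem_nhds h2] with s hs hs'
          simp only [hΦ, min_eq_right hs.le, max_eq_left hs'.le]
        refine ((((hsq.sub_const c).clog_real (Or.inl (hB' r h2.le))).const_add _)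
          |>.congr_of_eventuallyEq h3).congr_deriv ?_
        rw [hc, mul_comm z, div_eq_mul_inv]

/-- The logarithmic kernel is the composition of the two Cauchy kernels. -/
lemma integral_inv_mul_inv {R : ℝ} {z w : ℂ} (hz : z ∈ disk R) (hw : w ∈ disk R)
    (hzw : ‖z‖ ≠ ‖w‖) :
    ∫ ζ in disk R, (ζ - z)⁻¹ / (conj ζ - conj w) =
      Real.pi * Complex.log (((R : ℂ) ^ 2 - z * conj w) / ((‖z - w‖ ^ 2 : ℝ) : ℂ)) := by
  rcases lt_or_gt_of_ne hzw with h | h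
  · exact integral_inv_mul_inv_of_lt hw h
  · have := congrArg conj (integral_inv_mul_inv_of_lt hz h)
    rw [← integral_conj, map_mul, Complex.conj_ofReal, ← Complex.log_conj] at this
    · have e : ∀ ζ : ℂ, conj ((ζ - w)⁻¹ / (conj ζ - conj z)) = (ζ - z)⁻¹ / (conj ζ - conj w) :=
        fun ζ => by simp; ring
      simp only [e] at this
      rw [this, norm_sub_rev]
      simp [mul_comm]
    · have hzR : ‖z‖ ≤ R := by simpa [disk] using hz
      have hd0 : 0 < ‖w - z‖ ^ 2 := by
        have := norm_pos_iff.2 (sub_ne_zero.2 (fun h0 : w = z => hzw (by rw [h0])))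
        positivity
      have h1 : 0 < (((R ^ 2 : ℝ) : ℂ) - w * conj z).re := real_sub_re_pos (by
        rw [norm_mul, RCLike.norm_conj]; nlinarith [norm_nonneg w])
      have h2 : 0 < (((R : ℂ) ^ 2 - w * conj z) / ((‖w - z‖ ^ 2 : ℝ) : ℂ)).re := by
        rw [Complex.div_ofReal_re]
        push_cast at h1
        exact div_pos h1 hd0
      have h3 := Complex.abs_arg_lt_pi_div_two_iff.2 (Or.inl h2)
      intro h4
      rw [h4, abs_of_pos Real.pi_pos] at h3
      linarith [Real.pi_pos]

/-- The binomial expansion of `(b + (-b))^{n+1} = 0` with its term `k = 0` moved to the other side,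
after the absorption identity. -/
lemma sum_choose_div_eq (b : ℂ) (n : ℕ) :
    ∑ k ∈ Finset.range (n + 1), -(b ^ (k + 1)) / ((k + 1 : ℕ) : ℂ) *
      ((n.choose k : ℂ) * (-b) ^ (n - k)) = (-b) ^ (n + 1) / ((n : ℂ) + 1) := by
  have hn : (n : ℂ) + 1 ≠ 0 := by exact_mod_cast n.succ_ne_zero
  have h := add_pow b (-b) (n + 1)
  rw [add_neg_cancel, zero_pow n.succ_ne_zero, Finset.sum_range_succ'] at h
  rw [eq_div_iff hn, Finset.sum_mul]
  have e : ∀ k : ℕ, -(b ^ (k + 1)) / ((k + 1 : ℕ) : ℂ) * ((n.choose k : ℂ) * (-b) ^ (n - k)) *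
      ((n : ℂ) + 1) = -(b ^ (k + 1) * (-b) ^ (n + 1 - (k + 1)) * ((n + 1).choose (k + 1) : ℂ)) :=
    fun k => by
      have hk : ((k + 1 : ℕ) : ℂ) ≠ 0 := by exact_mod_cast k.succ_ne_zero
      have hch : ((n + 1).choose (k + 1) : ℂ) = ((n : ℂ) + 1) * (n.choose k : ℂ) / ((k + 1 : ℕ) : ℂ) := by
        rw [eq_div_iff hk]
        exact_mod_cast (Nat.add_one_mul_choose_eq n k).symm
      rw [hch, Nat.add_sub_add_right]
      field_simp
  simp only [e]
  rw [Finset.sum_neg_distrib]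
  simp only [pow_zero, Nat.sub_zero, Nat.choose_zero_right, Nat.cast_one, one_mul, mul_one] at h
  linear_combination h

lemma sum_choose_mul_pow_succ (a b : ℂ) (n k : ℕ) :
    ∑ j ∈ Finset.range (k + 2), ((n + 1).choose j : ℂ) * a ^ (k + 1 - j) * (-b) ^ j =
      (a - b) * (∑ j ∈ Finset.range (k + 1), (n.choose j : ℂ) * a ^ (k - j) * (-b) ^ j) +
        (n.choose (k + 1) : ℂ) * (-b) ^ (k + 1) := by
  have h1 : ∑ j ∈ Finset.range (k + 2), (n.choose j : ℂ) * a ^ (k + 1 - j) * (-b) ^ j =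
      a * (∑ j ∈ Finset.range (k + 1), (n.choose j : ℂ) * a ^ (k - j) * (-b) ^ j) +
        (n.choose (k + 1) : ℂ) * (-b) ^ (k + 1) := by
    rw [Finset.sum_range_succ, Finset.mul_sum]
    congr 1
    · refine Finset.sum_congr rfl fun j hj => ?_
      rw [show k + 1 - j = k - j + 1 by have := Finset.mem_range.1 hj; omega]
      ring
    · simp
  have h2 : ∑ j ∈ Finset.range (k + 2), ((n + 1).choose j : ℂ) * a ^ (k + 1 - j) * (-b) ^ j =
      (∑ j ∈ Finset.range (k + 2), (n.choose j : ℂ) * a ^ (k + 1 - j) * (-b) ^ j) +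
        -b * ∑ j ∈ Finset.range (k + 1), (n.choose j : ℂ) * a ^ (k - j) * (-b) ^ j := by
    rw [Finset.sum_range_succ', Finset.sum_range_succ' _ (k + 1), Finset.mul_sum, add_right_comm,
      ← Finset.sum_add_distrib]
    congr 1
    · refine Finset.sum_congr rfl fun j _ => ?_
      rw [Nat.choose_succ_succ, Nat.add_sub_add_right]
      push_cast
      ring
    · simp
  rw [h2, h1]; ring

/-- This is the recursion that the integral obeys when its numerator gains a factor `ζ - b`; the
added term is the plain area integral divided by `π`. Pascal's rule handles the inner sums. -/
lemma C₁_succ (a b : ℂ) (n : ℕ) :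
    C₁ a b (n + 2) = (a - b) * C₁ a b (n + 1) + (-b) ^ (n + 1) / ((n : ℂ) + 1) := by
  have hI : ∀ N : ℕ, ∀ F : ℕ → ℂ, ∑ l ∈ Finset.Icc 1 N, F l = ∑ k ∈ Finset.range N, F (k + 1) :=
    fun N F => by
      rw [Finset.range_eq_Ico, Finset.sum_Ico_add' F 0 N 1]; rfl
  simp only [C₁, hI]
  rw [← sum_choose_div_eq, Finset.mul_sum, show n + 2 - 1 = n + 1 by rfl, show n + 1 - 1 = n by rfl,
    Finset.sum_range_succ, Finset.sum_range_succ (fun k : ℕ => -(b ^ (k + 1)) / ((k + 1 : ℕ) : ℂ) *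
      ((n.choose k : ℂ) * (-b) ^ (n - k))), ← add_assoc, ← Finset.sum_add_distrib]
  congr 1
  · refine Finset.sum_congr rfl fun k hk => ?_
    have hk' := Finset.mem_range.1 hk
    obtain ⟨i, rfl⟩ := Nat.exists_eq_add_of_lt hk'
    rw [show k + i + 1 + 1 - (k + 1) = i + 1 by omega, show k + i + 1 - (k + 1) = i by omega,
      show k + i + 1 - k = i + 1 by omega, sum_choose_mul_pow_succ,
      Nat.choose_symm_of_eq_add (show k + i + 1 = k + (i + 1) by ring)]
    ring
  · simp

lemma integrableOn_sub_pow_mul_inv {R : ℝ} {z w : ℂ} (hzw : z ≠ w) (n : ℕ) :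
    IntegrableOn (fun ζ => (ζ - w) ^ n / (conj ζ - conj w) / (ζ - z)) (disk R) := by
  have hc : ContinuousOn (fun ζ : ℂ => (ζ - w) ^ n) (disk R) :=
    Continuous.continuousOn (by fun_prop)
  refine (Integrable.bdd_mul (c := (exists_norm_le_of_continuousOn hc).choose)
    (integrableOn_inv_mul_inv hzw)
    (hc.aestronglyMeasurable (measurableSet_disk R)) ?_).congr
    (Filter.Eventually.of_forall fun ζ => ?_)
  · exact (ae_restrict_iff' (measurableSet_disk R)).2
      (Filter.Eventually.of_forall (exists_norm_le_of_continuousOn hc).choose_spec.2)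
  · ring

/-- The transform of `(ζ - w)^n / (ζ̄ - w̄)`, by recursion on `n` from the logarithmic kernel. -/
lemma integral_sub_pow_div_conj_sub_div_sub {R : ℝ} {z w : ℂ} (hz : z ∈ disk R) (hw : w ∈ disk R)
    (hzw : ‖z‖ ≠ ‖w‖) (n : ℕ) :
    ∫ ζ in disk R, (ζ - w) ^ n / (conj ζ - conj w) / (ζ - z) =
      Real.pi * (C₁ z w (n + 1) + (z - w) ^ n *
        Complex.log (((R : ℂ) ^ 2 - z * conj w) / ((‖z - w‖ ^ 2 : ℝ) : ℂ))) := by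
  have hR : 0 ≤ R := (norm_nonneg z).trans (by simpa [disk] using hz)
  have hne : z ≠ w := fun h => hzw (by rw [h])
  induction n with
  | zero =>
    rw [show C₁ z w (0 + 1) = 0 by simp [C₁], pow_zero, zero_add, one_mul,
      ← integral_inv_mul_inv hz hw hzw]
    congr 1; funext ζ; ring
  | succ n ih =>
    have h := integral_sub_mul_div_sub w z
      (integrableOn_div_conj_sub (g := fun ζ => (ζ - w) ^ n) (R := R)
        (Continuous.continuousOn (by fun_prop)) w) (integrableOn_sub_pow_mul_inv hne n)
    rw [ih, integral_sub_pow_div_conj_sub hR w n hw] at h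
    rw [C₁_succ]
    have e : ∀ ζ : ℂ, (ζ - w) ^ (n + 1) / (conj ζ - conj w) / (ζ - z) =
      (ζ - w) * ((ζ - w) ^ n / (conj ζ - conj w)) / (ζ - z) := fun ζ => by ring
    simp only [e, h]
    ring

/-! ### Kernels of the iterated operators -/

/-- The logarithmic kernel is evaluated only for `|z| ≠ |w|`; the excluded circle is null, which
suffices under the integral sign. -/
lemma ae_norm_ne (R : ℝ) (z : ℂ) : ∀ᵐ w ∂volume.restrict (disk R), ‖z‖ ≠ ‖w‖ := by
  refine ae_restrict_of_ae ?_
  have h : volume (Metric.sphere (0 : ℂ) ‖z‖) = 0 := Measure.addHaar_sphere _ _ _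
  filter_upwards [compl_mem_ae_iff.2 h] with w hw h0
  exact hw (by rw [mem_sphere_zero_iff_norm, h0])

/-- `C₃` is the kernel of the composition. -/
lemma integral_eq_C₃ {R : ℝ} {z w : ℂ} (hz : z ∈ disk R) (hw : w ∈ disk R) (hzw : ‖z‖ ≠ ‖w‖)
    (m n : ℕ) :
    ∫ ζ in disk R, (conj ζ - conj z) ^ m / (ζ - z) * ((ζ - w) ^ n / (conj ζ - conj w)) =
      Real.pi * C₃ R z w (m + 1) (n + 1) := by
  have hR : 0 ≤ R := (norm_nonneg z).trans (by simpa [disk] using hz)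
  have hne : z ≠ w := fun h => hzw (by rw [h])
  have e : ∀ᵐ ζ ∂volume.restrict (disk R),
      (conj ζ - conj z) ^ m / (ζ - z) * ((ζ - w) ^ n / (conj ζ - conj w)) =
      (∑ l ∈ Finset.range m, ((m.choose (l + 1) : ℂ) * (conj w - conj z) ^ (m - (l + 1))) *
          ((conj ζ - conj w) ^ l * (ζ - w) ^ n / (ζ - z))) +
        (conj w - conj z) ^ m * ((ζ - w) ^ n / (conj ζ - conj w) / (ζ - z)) := by
    filter_upwards [ae_ne R w] with ζ hζ
    have h0 : conj ζ - conj w ≠ 0 := by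
      rw [← map_sub]; exact (map_ne_zero _).2 (sub_ne_zero.2 hζ)
    -- Positive powers of `ζ̄ - w̄` cancel the denominator and lead to `C₂`; the zeroth power leaves
    -- the term with `C₁` and the logarithm.
    rw [show conj ζ - conj z = (conj ζ - conj w) + (conj w - conj z) by ring, add_pow,
      Finset.sum_range_succ', add_div, add_mul, Finset.sum_div, Finset.sum_mul]
    congr 1
    · refine Finset.sum_congr rfl fun l _ => ?_
      field_simp
      ring
    · simp; ring
  have hi : ∀ l : ℕ, IntegrableOn (fun ζ =>
      ((m.choose (l + 1) : ℂ) * (conj w - conj z) ^ (m - (l + 1))) *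
          ((conj ζ - conj w) ^ l * (ζ - w) ^ n / (ζ - z))) (disk R) := fun l =>
    Integrable.const_mul (integrableOn_div_sub (Continuous.continuousOn (by fun_prop)) z) _
  rw [integral_congr_ae e, integral_add (integrable_finsetSum _ fun l _ => hi l)
    ((integrableOn_sub_pow_mul_inv hne n).const_mul _), integral_finsetSum _ fun l _ => hi l,
    integral_const_mul, integral_sub_pow_div_conj_sub_div_sub hz hw hzw, C₃]
  have hI : ∀ N : ℕ, ∀ F : ℕ → ℂ, ∑ l ∈ Finset.Icc 1 N, F l = ∑ k ∈ Finset.range N, F (k + 1) :=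
    fun N F => by
      rw [Finset.range_eq_Ico, Finset.sum_Ico_add' F 0 N 1]; rfl
  rw [hI, Nat.add_sub_cancel, Nat.add_sub_cancel]
  simp only [integral_const_mul, integral_conj_sub_pow_mul_sub_pow_div_sub hR _ n w hz,
    mul_left_comm _ (Real.pi : ℂ)]
  rw [← Finset.mul_sum]
  ring

/-- Interchange of integrals for two weakly singular kernels. -/
lemma integral_kernel_swap {R A B : ℝ} {z : ℂ} {a : ℂ → ℂ} {b : ℂ → ℂ → ℂ} {f : ℂ → ℂ}
    (hf : ContinuousOn f (disk R)) (ha : Measurable a) (hb : Measurable (Function.uncurry b))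
    (hA : ∀ ζ ∈ disk R, ‖a ζ‖ ≤ A * ‖ζ - z‖⁻¹) (hB0 : 0 ≤ B)
    (hB : ∀ ζ ∈ disk R, ∀ η ∈ disk R, ‖b ζ η‖ ≤ B * ‖η - ζ‖⁻¹) :
    IntegrableOn (fun η => (∫ ζ in disk R, a ζ * b ζ η) * f η) (disk R) ∧
    ∫ ζ in disk R, a ζ * ∫ η in disk R, b ζ η * f η =
      ∫ η in disk R, (∫ ζ in disk R, a ζ * b ζ η) * f η := by
  obtain ⟨C, hC0, hC⟩ := exists_norm_le_of_continuousOn hf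
  set M := ∫ u in Metric.closedBall (0 : ℂ) (2 * R), ‖u‖⁻¹
  have hae : ∀ {p : ℂ → Prop}, (∀ ζ ∈ disk R, p ζ) → ∀ᵐ ζ ∂volume.restrict (disk R), p ζ :=
    fun h => (ae_restrict_iff' (measurableSet_disk R)).2 (Filter.Eventually.of_forall h)
  have hfm : AEStronglyMeasurable f (volume.restrict (disk R)) :=
    hf.aestronglyMeasurable (measurableSet_disk R)
  have hbf : ∀ ζ ∈ disk R, ∀ η ∈ disk R, ‖b ζ η * f η‖ ≤ (B * C) * ‖η - ζ‖⁻¹ :=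
    fun ζ hζ η hη => by
      rw [norm_mul]
      calc ‖b ζ η‖ * ‖f η‖ ≤ (B * ‖η - ζ‖⁻¹) * C :=
            mul_le_mul (hB ζ hζ η hη) (hC η hη) (norm_nonneg _) (by positivity)
        _ = _ := by ring
  have hbi : ∀ ζ ∈ disk R, IntegrableOn (fun η => b ζ η * f η) (disk R) := fun ζ hζ =>
    integrableOn_of_norm_le_inv ((hb.of_uncurry_left).aestronglyMeasurable.mul hfm) (hbf ζ hζ)
  have hbn : ∀ ζ ∈ disk R, ∫ η in disk R, ‖b ζ η * f η‖ ≤ (B * C) * M := fun ζ hζ => by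
    calc ∫ η in disk R, ‖b ζ η * f η‖ ≤ ∫ η in disk R, (B * C) * ‖η - ζ‖⁻¹ :=
          integral_mono_ae (hbi ζ hζ).norm ((integrableOn_norm_sub_inv ζ R).const_mul _)
            (hae (hbf ζ hζ))
      _ = (B * C) * ∫ η in disk R, ‖η - ζ‖⁻¹ := integral_const_mul _ _
      _ ≤ _ := by gcongr; exact integral_norm_sub_inv_le hζ
  -- The inner integral of norms is at most `B * C * M` uniformly in `ζ`, so the outer one is again
  -- dominated by `1/|ζ - z|`.
  have hprod : Integrable (Function.uncurry fun ζ η => a ζ * b ζ η * f η)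
      ((volume.restrict (disk R)).prod (volume.restrict (disk R))) := by
    have hm : AEStronglyMeasurable (Function.uncurry fun ζ η => a ζ * b ζ η * f η)
        ((volume.restrict (disk R)).prod (volume.restrict (disk R))) :=
      ((ha.comp measurable_fst).aestronglyMeasurable.mul hb.aestronglyMeasurable).mul hfm.comp_snd
    rw [integrable_prod_iff hm]
    refine ⟨hae fun ζ hζ => ?_, ?_⟩
    · simp only [Function.uncurry_apply_pair, mul_assoc]
      exact (hbi ζ hζ).const_mul _
    · refine Integrable.mono' ((integrableOn_norm_sub_inv z R).const_mul (A * (B * C * M)))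
        hm.norm.integral_prod_right' (hae fun ζ hζ => ?_)
      rw [Real.norm_of_nonneg (integral_nonneg fun _ => norm_nonneg _)]
      simp only [Function.uncurry_apply_pair, mul_assoc (a ζ), norm_mul (a ζ)]
      rw [integral_const_mul]
      calc ‖a ζ‖ * ∫ η in disk R, ‖b ζ η * f η‖ ≤ (A * ‖ζ - z‖⁻¹) * (B * C * M) :=
            mul_le_mul (hA ζ hζ) (hbn ζ hζ) (integral_nonneg fun _ => norm_nonneg _)
              ((norm_nonneg _).trans (hA ζ hζ))
        _ = _ := by ring
  constructor
  · have := hprod.integral_prod_right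
    simpa only [Function.uncurry_apply_pair, integral_mul_const, IntegrableOn] using this
  · have := integral_integral_swap hprod
    simp only [mul_assoc] at this
    simp only [integral_const_mul] at this
    rw [this]
    simp only [← mul_assoc, integral_mul_const]

/-! ### Single-integral formulas for the iterates -/

lemma T_apply (R : ℝ) (f : ℂ → ℂ) (z : ℂ) :
    T R f z = -(1 / (Real.pi : ℂ)) * ∫ ζ in disk R, f ζ / (ζ - z) := by
  have : (Real.pi : ℂ) ≠ 0 := by exact_mod_cast Real.pi_ne_zero
  rw [T, wedgeIntegral]
  field_simp [Complex.I_ne_zero]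

lemma Tbar_eq_conj (R : ℝ) (f : ℂ → ℂ) :
    Tbar R f = fun z => conj (T R (fun ζ => conj (f ζ)) z) := by
  funext z
  have : (Real.pi : ℂ) ≠ 0 := by exact_mod_cast Real.pi_ne_zero
  rw [T_apply, map_mul, ← integral_conj, Tbar, wedgeIntegral]
  simp only [map_neg, map_div₀, map_one, Complex.conj_ofReal, Complex.conj_conj, map_sub]
  field_simp [Complex.I_ne_zero]

lemma Tbar_iterate_eq_conj (R : ℝ) (f : ℂ → ℂ) (n : ℕ) :
    (Tbar R)^[n] f = fun z => conj ((T R)^[n] (fun ζ => conj (f ζ)) z) := by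
  induction n with
  | zero => simp
  | succ n ih => simp only [Function.iterate_succ_apply', ih, Tbar_eq_conj, Complex.conj_conj]

lemma norm_sub_le_two_mul {R : ℝ} {z w : ℂ} (hz : z ∈ disk R) (hw : w ∈ disk R) :
    ‖z - w‖ ≤ 2 * R := by
  simp only [disk, mem_closedBall_zero_iff] at hz hw
  linarith [norm_sub_le z w]

lemma norm_pow_div_le {R : ℝ} {z w : ℂ} (hz : z ∈ disk R) (hw : w ∈ disk R) {u v : ℂ}
    (hu : ‖u‖ = ‖z - w‖) (hv : ‖v‖ = ‖z - w‖) (m : ℕ) :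
    ‖u ^ m / v‖ ≤ (2 * R) ^ m * ‖z - w‖⁻¹ := by
  rw [norm_div, norm_pow, hu, hv, div_eq_mul_inv]
  gcongr
  exact norm_sub_le_two_mul hz hw

lemma norm_conj_sub_conj (z w : ℂ) : ‖conj z - conj w‖ = ‖z - w‖ := by
  rw [← map_sub, RCLike.norm_conj]

/-- Partial fractions in `ζ` give a difference of two Cauchy integrals with poles `z` and `η`. The
constants `(-η̄)^{m+1}` cancel, leaving only a power of `z̄ - η̄`. -/
lemma integral_inv_mul_conj_sub_pow_div {R : ℝ} {z η : ℂ} (hz : z ∈ disk R) (hη : η ∈ disk R)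
    (hne : z ≠ η) (m : ℕ) :
    ∫ ζ in disk R, (ζ - z)⁻¹ * ((conj η - conj ζ) ^ m / (η - ζ)) =
      Real.pi / ((m : ℂ) + 1) * ((conj η - conj z) ^ (m + 1) / (η - z)) := by
  have hR : 0 ≤ R := (norm_nonneg z).trans (by simpa [disk] using hz)
  have h0 : η - z ≠ 0 := sub_ne_zero.2 hne.symm
  have e : ∀ᵐ ζ ∂volume.restrict (disk R), (ζ - z)⁻¹ * ((conj η - conj ζ) ^ m / (η - ζ)) =
      ((-1) ^ m / (η - z)) * ((conj ζ - conj η) ^ m / (ζ - z) - (conj ζ - conj η) ^ m / (ζ - η)) := by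
    filter_upwards [ae_ne R z, ae_ne R η] with ζ h1 h2
    have h1' := sub_ne_zero.2 h1
    have h2' := sub_ne_zero.2 h2
    have h3' := sub_ne_zero.2 h2.symm
    rw [show conj η - conj ζ = -1 * (conj ζ - conj η) by ring, mul_pow]
    field_simp
    ring
  rw [integral_congr_ae e, integral_const_mul, integral_sub
    (integrableOn_div_sub (Continuous.continuousOn (by fun_prop)) z)
    (integrableOn_div_sub (Continuous.continuousOn (by fun_prop)) η),
    integral_conj_sub_pow_div_sub hR η m hz, integral_conj_sub_pow_div_sub hR η m hη,
    show conj η - conj z = -1 * (conj z - conj η) by ring, mul_pow]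
  have hm : (m : ℂ) + 1 ≠ 0 := by exact_mod_cast m.succ_ne_zero
  simp only [sub_self]
  rw [zero_pow m.succ_ne_zero]
  field_simp
  ring

lemma measurable_conj : Measurable fun ζ : ℂ => conj ζ := Complex.continuous_conj.measurable

/-- The kernel of `T^{m+1}`. -/
lemma T_iterate_apply {R : ℝ} {f : ℂ → ℂ} (hf : ContinuousOn f (disk R)) (m : ℕ) {z : ℂ}
    (hz : z ∈ disk R) :
    (T R)^[m + 1] f z = (-1) ^ (m + 1) / ((m ! : ℂ) * Real.pi) *
      ∫ η in disk R, (conj η - conj z) ^ m / (η - z) * f η := by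
  have hπ : (Real.pi : ℂ) ≠ 0 := by exact_mod_cast Real.pi_ne_zero
  have hR : 0 ≤ R := (norm_nonneg z).trans (by simpa [disk] using hz)
  induction m generalizing z with
  | zero =>
    rw [Function.iterate_one, T_apply]
    have e : ∀ η : ℂ, (conj η - conj z) ^ 0 / (η - z) * f η = f η / (η - z) := fun η => by ring
    simp only [e]
    simp; ring
  | succ m ih =>
    rw [Function.iterate_succ_apply', T_apply]
    have hmf : (m ! : ℂ) ≠ 0 := by exact_mod_cast m.factorial_ne_zero
    have e : ∀ ζ ∈ disk R, (T R)^[m + 1] f ζ / (ζ - z) = ((-1) ^ (m + 1) / ((m ! : ℂ) * Real.pi)) *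
        ((ζ - z)⁻¹ * ∫ η in disk R, (conj η - conj ζ) ^ m / (η - ζ) * f η) := fun ζ hζ => by
      rw [ih hζ]; ring
    have hc := measurable_conj
    rw [setIntegral_congr_fun (measurableSet_disk R) e, integral_const_mul,
      (integral_kernel_swap (z := z) (A := 1) (B := (2 * R) ^ m)
      (b := fun ζ η => (conj η - conj ζ) ^ m / (η - ζ)) hf (by fun_prop)
      (by unfold Function.uncurry; fun_prop)
      (fun ζ _ => by simp) (by positivity) (fun ζ hζ η hη => norm_pow_div_le hη hζ
        (norm_conj_sub_conj _ _) rfl m)).2]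
    have e2 : ∀ᵐ η ∂volume.restrict (disk R),
        (∫ ζ in disk R, (ζ - z)⁻¹ * ((conj η - conj ζ) ^ m / (η - ζ))) * f η =
        Real.pi / ((m : ℂ) + 1) * ((conj η - conj z) ^ (m + 1) / (η - z) * f η) := by
      filter_upwards [ae_ne R z, ae_restrict_mem (measurableSet_disk R)] with η h1 h2
      rw [integral_inv_mul_conj_sub_pow_div hz h2 h1.symm]; ring
    rw [integral_congr_ae e2, integral_const_mul, Nat.factorial_succ]
    have hm : (m : ℂ) + 1 ≠ 0 := by exact_mod_cast m.succ_ne_zero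
    push_cast
    field_simp
    ring

/-- The kernel of `T̄^{n+1}`. -/
lemma Tbar_iterate_apply {R : ℝ} {f : ℂ → ℂ} (hf : ContinuousOn f (disk R)) (n : ℕ) {z : ℂ}
    (hz : z ∈ disk R) :
    (Tbar R)^[n + 1] f z = (-1) ^ (n + 1) / ((n ! : ℂ) * Real.pi) *
      ∫ η in disk R, (η - z) ^ n / (conj η - conj z) * f η := by
  rw [Tbar_iterate_eq_conj]
  simp only
  rw [T_iterate_apply (f := fun ζ => conj (f ζ))
    (Complex.continuous_conj.comp_continuousOn hf) n hz, map_mul, ← integral_conj]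
  simp

/-- The kernel of `T^{m+1} T̄^{n+1}`. -/
lemma T_iterate_Tbar_iterate_apply {R : ℝ} {f : ℂ → ℂ} (hf : ContinuousOn f (disk R)) (m n : ℕ)
    (hg : ContinuousOn ((Tbar R)^[n + 1] f) (disk R)) {z : ℂ} (hz : z ∈ disk R) :
    IntegrableOn (fun η => C₃ R z η (m + 1) (n + 1) * f η) (disk R) ∧
    (T R)^[m + 1] ((Tbar R)^[n + 1] f) z = (-1) ^ (m + 1) / ((m ! : ℂ) * (n ! : ℂ) * Real.pi) *
      ∫ η in disk R, C₃ R z η (m + 1) (n + 1) * f η := by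
  have hπ : (Real.pi : ℂ) ≠ 0 := by exact_mod_cast Real.pi_ne_zero
  have hR : 0 ≤ R := (norm_nonneg z).trans (by simpa [disk] using hz)
  have hc := measurable_conj
  obtain ⟨h1, h2⟩ := integral_kernel_swap (z := z) (A := (2 * R) ^ m) (B := (2 * R) ^ n)
    (a := fun ζ => (conj ζ - conj z) ^ m / (ζ - z))
    (b := fun ζ η => (η - ζ) ^ n / (conj η - conj ζ)) hf (by fun_prop)
    (by unfold Function.uncurry; fun_prop)
    (fun ζ hζ => norm_pow_div_le hζ hz (norm_conj_sub_conj _ _) rfl m) (by positivity)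
    (fun ζ hζ η hη => norm_pow_div_le hη hζ rfl (norm_conj_sub_conj _ _) n)
  have e : ∀ᵐ η ∂volume.restrict (disk R),
      (∫ ζ in disk R, (conj ζ - conj z) ^ m / (ζ - z) * ((η - ζ) ^ n / (conj η - conj ζ))) * f η =
      (-1) ^ (n + 1) * Real.pi * (C₃ R z η (m + 1) (n + 1) * f η) := by
    filter_upwards [ae_norm_ne R z, ae_restrict_mem (measurableSet_disk R)] with η h3 h4
    -- Reversing both differences costs `(-1)^{n+1}`, which cancels the sign of the kernel of
    -- `T̄^{n+1}`; only `(-1)^{m+1}` survives.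
    have e3 : ∀ ζ : ℂ, (conj ζ - conj z) ^ m / (ζ - z) * ((η - ζ) ^ n / (conj η - conj ζ)) =
        (-1) ^ (n + 1) *
          ((conj ζ - conj z) ^ m / (ζ - z) * ((ζ - η) ^ n / (conj ζ - conj η))) := fun ζ => by
      rw [show η - ζ = -1 * (ζ - η) by ring, show conj η - conj ζ = -(conj ζ - conj η) by ring,
        mul_pow, div_neg]
      ring
    simp only [e3]
    rw [integral_const_mul, integral_eq_C₃ hz h4 h3]
    ring
  constructor
  · refine (((Integrable.congr h1 e).const_mul ((-1) ^ (n + 1) / (Real.pi : ℂ)))).congr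
      (Filter.Eventually.of_forall fun η => ?_)
    have : ((-1 : ℂ) ^ (n + 1)) * (-1) ^ (n + 1) = 1 := by rw [← mul_pow]; simp
    simp only
    field_simp
    linear_combination (C₃ R z η (m + 1) (n + 1) * f η) * this
  · rw [T_iterate_apply hg m hz]
    have e4 : ∀ ζ ∈ disk R, (conj ζ - conj z) ^ m / (ζ - z) * (Tbar R)^[n + 1] f ζ =
        ((-1) ^ (n + 1) / ((n ! : ℂ) * Real.pi)) * ((conj ζ - conj z) ^ m / (ζ - z) *
          ∫ η in disk R, (η - ζ) ^ n / (conj η - conj ζ) * f η) := fun ζ hζ => by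
      rw [Tbar_iterate_apply hf n hζ]; ring
    rw [setIntegral_congr_fun (measurableSet_disk R) e4, integral_const_mul, h2,
      integral_congr_ae e, integral_const_mul]
    have : ((-1 : ℂ) ^ (n + 1)) * (-1) ^ (n + 1) = 1 := by rw [← mul_pow]; simp
    have hm : (m ! : ℂ) ≠ 0 := by exact_mod_cast m.factorial_ne_zero
    have hn : (n ! : ℂ) ≠ 0 := by exact_mod_cast n.factorial_ne_zero
    field_simp
    linear_combination (∫ η in disk R, C₃ R z η (m + 1) (n + 1) * f η) * this

/-! ### A Green formula on the disk without boundary term -/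

/-- The real linear map `p dz + q dz̄`. -/
noncomputable def wirtinger (p q : ℂ) : ℂ →L[ℝ] ℂ :=
  p • ContinuousLinearMap.id ℝ ℂ + q • (Complex.conjCLE : ℂ →L[ℝ] ℂ)

@[simp] lemma wirtinger_apply (p q v : ℂ) : wirtinger p q v = p * v + q * conj v := by
  simp [wirtinger]

lemma hasDerivAt_conj_circleMap (r θ : ℝ) :
    HasDerivAt (fun θ => conj (circleMap 0 r θ)) (conj (circleMap 0 r θ * Complex.I)) θ :=
  (Complex.conjCLE : ℂ →L[ℝ] ℂ).hasFDerivAt.comp_hasDerivAt θ (hasDerivAt_circleMap 0 r θ)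

lemma integrableOn_disk_bdd_mul {R C : ℝ} {c g : ℂ → ℂ} (hg : IntegrableOn g (disk R))
    (hc : AEStronglyMeasurable c (volume.restrict (disk R))) (hC : ∀ ζ ∈ disk R, ‖c ζ‖ ≤ C) :
    IntegrableOn (fun ζ => c ζ * g ζ) (disk R) :=
  Integrable.bdd_mul (c := C) hg hc
    ((ae_restrict_iff' (measurableSet_disk R)).2 (Filter.Eventually.of_forall hC))

/-- The angular part: the integral over each circle vanishes by periodicity. -/
lemma circleAverage_angular_eq_zero {r : ℝ} {g p q : ℂ → ℂ}
    (hd : ∀ ζ : ℂ, ‖ζ‖ = r → HasFDerivAt g (wirtinger (p ζ) (q ζ)) ζ) (hr : 0 < r) :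
    Real.circleAverage (fun ζ => -conj ζ * g ζ + p ζ * (ζ * conj ζ) - conj ζ ^ 2 * q ζ) 0 r = 0 := by
  rw [Real.circleAverage]
  set F : ℂ → ℂ := fun ζ => -conj ζ * g ζ + p ζ * (ζ * conj ζ) - conj ζ ^ 2 * q ζ
  -- If `F` is integrable on the circle, it is the angular derivative of the periodic function
  -- `-iζ̄g`; otherwise the integral is `0` by convention.
  by_cases hi : IntervalIntegrable (fun θ => F (circleMap 0 r θ)) volume 0 (2 * Real.pi)
  · have h : ∀ θ : ℝ, HasDerivAt
        (fun θ => -Complex.I * (conj (circleMap 0 r θ) * g (circleMap 0 r θ)))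
        (F (circleMap 0 r θ)) θ := fun θ => by
      have h1 := (hd (circleMap 0 r θ) (by simp [abs_of_pos hr])).comp_hasDerivAt θ
        (hasDerivAt_circleMap 0 r θ)
      refine (((hasDerivAt_conj_circleMap r θ).mul h1).const_mul (-Complex.I)).congr_deriv ?_
      simp only [wirtinger_apply, map_mul, Complex.conj_I, F, Function.comp_apply]
      linear_combination (conj (circleMap 0 r θ) * g (circleMap 0 r θ) -
        p (circleMap 0 r θ) * circleMap 0 r θ * conj (circleMap 0 r θ) +
        conj (circleMap 0 r θ) ^ 2 * q (circleMap 0 r θ)) * Complex.I_sq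
    rw [intervalIntegral.integral_eq_sub_of_hasDerivAt (fun θ _ => h θ) hi]
    have := periodic_circleMap 0 r 0
    rw [zero_add] at this
    rw [this, sub_self, smul_zero]
  · rw [intervalIntegral.integral_undef hi, smul_zero]

/-- The radial part: the integral over each ray vanishes as the field is tangent to the boundary. -/
lemma integral_radial_eq_zero {R C : ℝ} (hR : 0 < R) {z : ℂ} {g p q : ℂ → ℂ} {θ : ℝ}
    (hθ : ∀ r : ℝ, 0 < r → circleMap 0 r θ ≠ z)
    (hg : ContinuousOn g (disk R \ {z})) (hC : ∀ ζ ∈ disk R, ‖g ζ‖ ≤ C)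
    (hd : ∀ ζ : ℂ, ‖ζ‖ < R → ζ ≠ z → HasFDerivAt g (wirtinger (p ζ) (q ζ)) ζ) :
    ∫ r in (0 : ℝ)..R, ((1 - 3 * (r : ℂ) ^ 2 / R ^ 2) * g (circleMap 0 r θ) +
      r * (1 - (r : ℂ) ^ 2 / R ^ 2) * (p (circleMap 0 r θ) * circleMap 0 1 θ +
        q (circleMap 0 r θ) * conj (circleMap 0 1 θ))) = 0 := by
  set u := circleMap 0 1 θ with hu
  have hcm : ∀ r : ℝ, circleMap 0 r θ = r * u := fun r => by simp [hu, circleMap]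
  have hun : ‖u‖ = 1 := by simp [hu]
  -- The weight vanishes at `r = 0` and `r = R`. Its zero at `0` also gives continuity there from
  -- boundedness of `g` alone, as needed when `z = 0`.
  set P : ℝ → ℂ := fun r => ((r : ℂ) - (r : ℂ) ^ 3 / R ^ 2) * g (r * u) with hP
  have hR' : (R : ℂ) ≠ 0 := by exact_mod_cast hR.ne'
  have hmem : ∀ r ∈ Icc 0 R, (r : ℂ) * u ∈ disk R := fun r hr => by
    simp [disk, hun, abs_of_nonneg hr.1, hr.2]
  have hPc : ContinuousOn P (Icc 0 R) := by
    intro r hr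
    rcases hr.1.eq_or_lt with rfl | h0
    · have hP0 : P 0 = 0 := by simp [hP]
      rw [ContinuousWithinAt, hP0]
      have ht : Filter.Tendsto (fun r : ℝ => ‖(r : ℂ) - (r : ℂ) ^ 3 / R ^ 2‖ * C)
          (nhdsWithin 0 (Icc 0 R)) (nhds 0) := by
        have : Continuous fun r : ℝ => ‖(r : ℂ) - (r : ℂ) ^ 3 / R ^ 2‖ * C := by fun_prop
        have h := (this.tendsto 0).mono_left (nhdsWithin_le_nhds (s := Icc 0 R))
        simpa using h
      refine squeeze_zero_norm' ?_ ht
      filter_upwards [self_mem_nhdsWithin] with s hs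
      rw [hP, norm_mul]
      gcongr
      exact hC _ (hmem s hs)
    · have h1 : ContinuousWithinAt (fun r : ℝ => g (r * u)) (Icc 0 R ∩ Ioi 0) r := by
        refine ContinuousWithinAt.comp (t := disk R \ {z}) (hg _ ⟨hmem r hr, ?_⟩)
          (Continuous.continuousWithinAt (by fun_prop)) fun s hs => ⟨hmem s hs.1, ?_⟩
        · simpa [← hcm] using hθ r h0
        · simpa [← hcm] using hθ s hs.2
      have h2 := (continuousWithinAt_inter (Ioi_mem_nhds h0)).1 h1
      exact ContinuousWithinAt.mul (Continuous.continuousWithinAt (by fun_prop)) h2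
  set F : ℝ → ℂ := fun r => ((1 - 3 * (r : ℂ) ^ 2 / R ^ 2) * g (circleMap 0 r θ) +
      r * (1 - (r : ℂ) ^ 2 / R ^ 2) * (p (circleMap 0 r θ) * u +
        q (circleMap 0 r θ) * conj u))
  by_cases hi : IntervalIntegrable F volume 0 R
  · rw [intervalIntegral.integral_eq_sub_of_hasDerivAt_of_le hR.le hPc (fun r hr => ?_) hi]
    · simp [hP]; field_simp; simp
    · have hlin : HasDerivAt (fun r : ℝ => (r : ℂ) * u) u r := by
        simpa using (Complex.ofRealCLM.hasDerivAt (x := r)).mul_const u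
      have h1 := (hd (r * u) (by simp [hun, abs_of_pos hr.1, hr.2])
        (by simpa [← hcm] using hθ r hr.1)).comp_hasDerivAt r hlin
      have h2 : HasDerivAt (fun r : ℝ => (r : ℂ) - (r : ℂ) ^ 3 / R ^ 2)
          (1 - 3 * (r : ℂ) ^ 2 / R ^ 2) r := by
        have h3 := Complex.ofRealCLM.hasDerivAt (x := r)
        refine (h3.sub ((h3.fun_pow 3).div_const ((R : ℂ) ^ 2))).congr_deriv ?_
        simp
      refine (h2.mul h1).congr_deriv ?_
      simp only [wirtinger_apply, F, hcm, Function.comp_apply]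
      ring
  · exact intervalIntegral.integral_undef hi

/-- `∫_D (∂g - ∂̄(ζ̄² g) / R²) = 0`: the vector field is tangent to the boundary circle, so that no
boundary term appears. The function may be singular, but bounded, at one point. -/
lemma integral_tangent_eq_zero {R C : ℝ} (hR : 0 < R) {z : ℂ} {g p q : ℂ → ℂ}
    (hg : ContinuousOn g (disk R \ {z})) (hC : ∀ ζ ∈ disk R, ‖g ζ‖ ≤ C)
    (hgm : AEStronglyMeasurable g (volume.restrict (disk R)))
    (hd : ∀ ζ : ℂ, ‖ζ‖ < R → ζ ≠ z → HasFDerivAt g (wirtinger (p ζ) (q ζ)) ζ)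
    (hp : IntegrableOn p (disk R)) (hq : IntegrableOn q (disk R)) :
    ∫ ζ in disk R, (p ζ - (conj ζ ^ 2 * q ζ + 2 * conj ζ * g ζ) / (R : ℂ) ^ 2) = 0 := by
  have hR' : (R : ℂ) ≠ 0 := by exact_mod_cast hR.ne'
  have hmc := measurable_conj
  have hn : ∀ ζ ∈ disk R, ‖ζ‖ ≤ R := fun ζ hζ => by simpa [disk] using hζ
  -- Writing `∂` and `∂̄` in polar coordinates splits the integrand as `A + B`. With `u = ζ/|ζ|`, `r
  -- A` is `ū/2` times the radial derivative of `(r - r³/R²) g`, and `B` is a radial factor times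
  -- the angular derivative of `-iζ̄g`.
  set A : ℂ → ℂ := fun ζ => ((1 - 3 * (‖ζ‖ : ℂ) ^ 2 / R ^ 2) * conj ζ / (2 * (‖ζ‖ : ℂ) ^ 2)) * g ζ +
    ((1 - (‖ζ‖ : ℂ) ^ 2 / R ^ 2) / 2) * p ζ +
    ((1 - (‖ζ‖ : ℂ) ^ 2 / R ^ 2) / 2 * (conj ζ ^ 2 / (‖ζ‖ : ℂ) ^ 2)) * q ζ with hA
  set B : ℂ → ℂ := fun ζ => (1 + (‖ζ‖ : ℂ) ^ 2 / R ^ 2) / (2 * (‖ζ‖ : ℂ) ^ 2) *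
    (-conj ζ * g ζ + p ζ * (ζ * conj ζ) - conj ζ ^ 2 * q ζ) with hB
  have hs : ∀ ζ ∈ disk R, ‖1 - (‖ζ‖ : ℂ) ^ 2 / R ^ 2‖ ≤ 1 := fun ζ hζ => by
    have h1 : ‖ζ‖ ^ 2 / R ^ 2 ≤ 1 := by
      rw [div_le_one (by positivity)]; gcongr; exact hn ζ hζ
    have h2 : (1 : ℂ) - (‖ζ‖ : ℂ) ^ 2 / R ^ 2 = ((1 - ‖ζ‖ ^ 2 / R ^ 2 : ℝ) : ℂ) := by push_cast; rfl
    rw [h2, Complex.norm_real, Real.norm_of_nonneg (by linarith)]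
    have : 0 ≤ ‖ζ‖ ^ 2 / R ^ 2 := by positivity
    linarith
  have hs3 : ∀ ζ ∈ disk R, ‖1 - 3 * (‖ζ‖ : ℂ) ^ 2 / R ^ 2‖ ≤ 2 := fun ζ hζ => by
    have h1 : ‖ζ‖ ^ 2 / R ^ 2 ≤ 1 := by
      rw [div_le_one (by positivity)]; gcongr; exact hn ζ hζ
    have h3 : 0 ≤ ‖ζ‖ ^ 2 / R ^ 2 := by positivity
    have h2 : (1 : ℂ) - 3 * (‖ζ‖ : ℂ) ^ 2 / R ^ 2 = ((1 - 3 * (‖ζ‖ ^ 2 / R ^ 2) : ℝ) : ℂ) := by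
      push_cast; ring
    rw [h2, Complex.norm_real, Real.norm_eq_abs, abs_le]
    constructor <;> linarith
  have hAi : IntegrableOn A (disk R) := by
    refine Integrable.add (Integrable.add ?_ ?_) ?_
    · refine integrableOn_of_norm_le_inv (z := 0) (C := C) ?_ fun ζ hζ => ?_
      · exact (Measurable.aestronglyMeasurable (by fun_prop)).mul hgm
      · rw [norm_mul, norm_div, norm_mul, norm_mul, norm_pow, Complex.norm_real, norm_norm,
          RCLike.norm_conj, Complex.norm_ofNat, sub_zero]
        rcases (norm_nonneg ζ).eq_or_lt with h0 | h0
        · simp [← h0]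
        have h1 := hs3 ζ hζ
        calc _ ≤ 2 * ‖ζ‖ / (2 * ‖ζ‖ ^ 2) * C := by
              gcongr
              exact hC ζ hζ
          _ = _ := by field_simp
    · refine integrableOn_disk_bdd_mul (C := 1 / 2) hp
        (Measurable.aestronglyMeasurable (by fun_prop)) fun ζ hζ => ?_
      rw [norm_div, Complex.norm_ofNat]
      gcongr
      exact hs ζ hζ
    · refine integrableOn_disk_bdd_mul (C := 1 / 2 * 1) hq
        (Measurable.aestronglyMeasurable (by fun_prop)) fun ζ hζ => ?_
      rw [norm_mul, norm_div, norm_div, norm_pow, norm_pow, Complex.norm_real, norm_norm,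
          RCLike.norm_conj, Complex.norm_ofNat]
      gcongr
      · exact hs ζ hζ
      · exact div_self_le_one _
  have hi : IntegrableOn (fun ζ => p ζ - (conj ζ ^ 2 * q ζ + 2 * conj ζ * g ζ) / (R : ℂ) ^ 2)
      (disk R) := by
    have hgi : IntegrableOn g (disk R) := by
      simpa using integrableOn_disk_bdd_mul (g := fun _ => 1)
        (continuousOn_const.integrableOn_compact (isCompact_closedBall _ _)) hgm hC
    refine hp.sub (Integrable.div_const (Integrable.add ?_ ?_) _)
    · refine integrableOn_disk_bdd_mul (C := R ^ 2) hq
        (Measurable.aestronglyMeasurable (by fun_prop)) fun ζ hζ => ?_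
      rw [norm_pow, RCLike.norm_conj]
      gcongr
      exact hn ζ hζ
    · refine integrableOn_disk_bdd_mul (C := 2 * R) hgi
        (Measurable.aestronglyMeasurable (by fun_prop)) fun ζ hζ => ?_
      rw [norm_mul, RCLike.norm_conj, Complex.norm_ofNat]
      gcongr
      exact hn ζ hζ
  have hAB : ∀ᵐ ζ ∂volume.restrict (disk R),
      p ζ - (conj ζ ^ 2 * q ζ + 2 * conj ζ * g ζ) / (R : ℂ) ^ 2 - A ζ = B ζ := by
    filter_upwards [ae_ne R 0] with ζ hζ
    have hζ' : (‖ζ‖ : ℂ) ≠ 0 := by simpa using hζ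
    have h2 : ζ * conj ζ = (‖ζ‖ : ℂ) ^ 2 := by
      rw [Complex.mul_conj, Complex.normSq_eq_norm_sq]; push_cast; rfl
    simp only [hA, hB, h2]
    field_simp
    ring
  have hBi : IntegrableOn B (disk R) := (Integrable.sub hi hAi).congr hAB
  have hB0 : ∫ ζ in disk R, B ζ = 0 := by
    rw [integral_disk_of_circleAverage (Φ := fun _ => 0) hR.le hBi (countable_singleton ‖z‖)
      continuousOn_const]
    · simp
    · rintro r ⟨⟨hr0, hrR⟩, hrz⟩
      have h1 : Real.circleAverage B 0 r = 0 := by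
        have h2 := circleAverage_angular_eq_zero (r := r) (g := g) (p := p) (q := q)
          (fun ζ hζ => hd ζ (hζ ▸ hrR) fun h => hrz (by rw [← hζ, h]; rfl)) hr0
        rw [Real.circleAverage_congr_sphere
          (f₂ := ((1 + (r : ℂ) ^ 2 / R ^ 2) / (2 * (r : ℂ) ^ 2)) •
            fun ζ => -conj ζ * g ζ + p ζ * (ζ * conj ζ) - conj ζ ^ 2 * q ζ) fun ζ hζ => ?_,
          Real.circleAverage_smul, h2, smul_zero]
        rw [mem_sphere_zero_iff_norm, abs_of_pos hr0] at hζ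
        simp only [hB, hζ, Pi.smul_apply, smul_eq_mul]
      rw [h1, mul_zero]
      exact hasDerivAt_const _ _
  have hA0 : ∫ ζ in disk R, A ζ = 0 := by
    have h := integrableOn_polarRect hAi
    rw [integral_disk_eq_polarRect, polarRect, Measure.volume_eq_prod, ← Measure.prod_restrict,
      integral_prod_symm]
    · refine integral_eq_zero_of_ae ?_
      have h1 : ∀ᵐ θ : ℝ ∂volume.restrict (Ioo (-Real.pi) Real.pi), θ ≠ Complex.arg z :=
        ae_restrict_of_ae (Measure.ae_ne volume _)
      filter_upwards [h1, ae_restrict_mem measurableSet_Ioo] with θ hθ1 hθ2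
      have h3 := integral_radial_eq_zero (θ := θ) hR (fun r hr h0 => hθ1 (by
        rw [← h0, circleMap, zero_add, Complex.exp_mul_I]
        exact (Complex.arg_mul_cos_add_sin_mul_I hr ⟨hθ2.1, hθ2.2.le⟩).symm)) hg hC hd
      rw [← intervalIntegral.integral_of_le hR.le]
      have h4 : ∀ r ∈ uIcc 0 R, r ≠ 0 → r • A (circleMap 0 r θ) = conj (circleMap 0 1 θ) / 2 *
        ((1 - 3 * (r : ℂ) ^ 2 / R ^ 2) * g (circleMap 0 r θ) +
          r * (1 - (r : ℂ) ^ 2 / R ^ 2) * (p (circleMap 0 r θ) * circleMap 0 1 θ +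
          q (circleMap 0 r θ) * conj (circleMap 0 1 θ))) := fun r hr hr0 => by
        rw [uIcc_of_le hR.le] at hr
        have e1 : conj (circleMap 0 r θ) = r * conj (circleMap 0 1 θ) := by simp [circleMap]
        have e2 : conj (circleMap 0 1 θ) * circleMap 0 1 θ = 1 := by
          rw [mul_comm, Complex.mul_conj, Complex.normSq_eq_norm_sq]; simp
        have e3 : ‖circleMap 0 r θ‖ = r := by simp [abs_of_nonneg hr.1]
        have hr0' : (r : ℂ) ≠ 0 := by exact_mod_cast hr0
        simp only [hA, e1, e3, Complex.real_smul]
        field_simp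
        linear_combination (-r * ((R : ℂ) ^ 2 - r ^ 2) * p (circleMap 0 r θ)) * e2
      have h5 : ∫ r in (0 : ℝ)..R, r • A (circleMap 0 r θ) = ∫ r in (0 : ℝ)..R,
          conj (circleMap 0 1 θ) / 2 *
        ((1 - 3 * (r : ℂ) ^ 2 / R ^ 2) * g (circleMap 0 r θ) +
          r * (1 - (r : ℂ) ^ 2 / R ^ 2) * (p (circleMap 0 r θ) * circleMap 0 1 θ +
          q (circleMap 0 r θ) * conj (circleMap 0 1 θ))) := by
        refine intervalIntegral.integral_congr_ae ?_
        filter_upwards [Measure.ae_ne volume (0 : ℝ)] with r hr0 hr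
        exact h4 r (uIoc_subset_uIcc hr) hr0
      simp only [Pi.zero_apply]
      rw [h5, intervalIntegral.integral_const_mul, h3, mul_zero]
    · rw [Measure.prod_restrict]
      exact h
  have hsum : ∫ ζ in disk R, (p ζ - (conj ζ ^ 2 * q ζ + 2 * conj ζ * g ζ) / (R : ℂ) ^ 2) =
      ∫ ζ in disk R, (A ζ + B ζ) := by
    refine integral_congr_ae ?_
    filter_upwards [hAB] with ζ hζ
    rw [← hζ]; ring
  rw [hsum, integral_add hAi hBi, hA0, hB0, add_zero]

/-! ### Hölder bounds -/

/-- The Hölder condition on the disk, in terms of norms. -/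
def HasHolderBound {E : Type*} [NormedAddCommGroup E] (α : ℝ≥0) (R : ℝ) (F : ℂ → E) : Prop :=
  ∃ C : ℝ, 0 ≤ C ∧ ∀ z ∈ disk R, ∀ w ∈ disk R, ‖F z - F w‖ ≤ C * ‖z - w‖ ^ (α : ℝ)

lemma exists_holderOnWith_iff {E : Type*} [NormedAddCommGroup E] {α : ℝ≥0} {R : ℝ} {F : ℂ → E} :
    (∃ C : ℝ≥0, HolderOnWith C α F (disk R)) ↔ HasHolderBound α R F := by
  constructor
  · rintro ⟨C, hC⟩
    refine ⟨C, C.2, fun z hz w hw => ?_⟩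
    rw [← dist_eq_norm, ← dist_eq_norm]
    exact hC.dist_le hz hw
  · rintro ⟨C, hC0, hC⟩
    refine ⟨C.toNNReal, fun z hz w hw => ?_⟩
    rw [edist_dist, edist_dist, ENNReal.ofReal_rpow_of_nonneg dist_nonneg α.coe_nonneg, dist_eq_norm,
      dist_eq_norm]
    exact (ENNReal.ofReal_le_ofReal (hC z hz w hw)).trans_eq (ENNReal.ofReal_mul hC0)

lemma isHolder_iff {α : ℝ≥0} {R : ℝ} {f : ℂ → ℂ} : IsHolder α R f ↔ HasHolderBound α R f :=
  exists_holderOnWith_iff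

lemma HasHolderBound.continuousOn {α : ℝ≥0} {R : ℝ} {f : ℂ → ℂ} (hα0 : 0 < α)
    (hf : HasHolderBound α R f) : ContinuousOn f (disk R) := by
  obtain ⟨C, hC⟩ := exists_holderOnWith_iff.2 hf
  exact hC.continuousOn hα0

lemma HasHolderBound.congr {E : Type*} [NormedAddCommGroup E] {α : ℝ≥0} {R : ℝ} {F G : ℂ → E}
    (hF : HasHolderBound α R F) (h : EqOn F G (disk R)) : HasHolderBound α R G := by
  obtain ⟨C, hC0, hC⟩ := hF
  exact ⟨C, hC0, fun z hz w hw => by rw [← h hz, ← h hw]; exact hC z hz w hw⟩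

lemma HasHolderBound.add {E : Type*} [NormedAddCommGroup E] {α : ℝ≥0} {R : ℝ} {F G : ℂ → E}
    (hF : HasHolderBound α R F) (hG : HasHolderBound α R G) :
    HasHolderBound α R (fun z => F z + G z) := by
  obtain ⟨C, hC0, hC⟩ := hF
  obtain ⟨C', hC0', hC'⟩ := hG
  refine ⟨C + C', by positivity, fun z hz w hw => ?_⟩
  rw [add_sub_add_comm, add_mul]
  exact (norm_add_le _ _).trans (add_le_add (hC z hz w hw) (hC' z hz w hw))

lemma HasHolderBound.mul {α : ℝ≥0} {R : ℝ} {f g : ℂ → ℂ} (hα0 : 0 < α)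
    (hf : HasHolderBound α R f) (hg : HasHolderBound α R g) :
    HasHolderBound α R (fun z => f z * g z) := by
  obtain ⟨A, hA0, hA⟩ := exists_norm_le_of_continuousOn (hf.continuousOn hα0)
  obtain ⟨B, hB0, hB⟩ := exists_norm_le_of_continuousOn (hg.continuousOn hα0)
  obtain ⟨C, hC0, hC⟩ := hf
  obtain ⟨C', hC0', hC'⟩ := hg
  refine ⟨A * C' + C * B, by positivity, fun z hz w hw => ?_⟩
  calc ‖f z * g z - f w * g w‖ = ‖f z * (g z - g w) + (f z - f w) * g w‖ := by congr 1; ring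
    _ ≤ ‖f z‖ * ‖g z - g w‖ + ‖f z - f w‖ * ‖g w‖ := by
        refine (norm_add_le _ _).trans ?_
        rw [norm_mul, norm_mul]
    _ ≤ A * (C' * ‖z - w‖ ^ (α : ℝ)) + (C * ‖z - w‖ ^ (α : ℝ)) * B := by
        gcongr
        exacts [hA z hz, hC' z hz w hw, hC z hz w hw, hB w hw]
    _ = _ := by ring

lemma HasHolderBound.of_lipschitz {E : Type*} [NormedAddCommGroup E] {α : ℝ≥0} {R L : ℝ}
    {F : ℂ → E} (hα1 : α < 1) (hL0 : 0 ≤ L)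
    (hL : ∀ z ∈ disk R, ∀ w ∈ disk R, ‖F z - F w‖ ≤ L * ‖z - w‖) : HasHolderBound α R F := by
  refine ⟨L * (2 * |R|) ^ (1 - α : ℝ), by positivity, fun z hz w hw => ?_⟩
  refine (hL z hz w hw).trans ?_
  rw [mul_assoc]
  gcongr
  have h1 : ‖z - w‖ ≤ 2 * |R| :=
    (norm_sub_le_two_mul hz hw).trans (by gcongr; exact le_abs_self R)
  have hα1' : (α : ℝ) < 1 := by exact_mod_cast hα1
  calc ‖z - w‖ = ‖z - w‖ ^ (1 - α + α : ℝ) := by simp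
    _ = ‖z - w‖ ^ (1 - α : ℝ) * ‖z - w‖ ^ (α : ℝ) :=
        Real.rpow_add_of_nonneg (norm_nonneg _) (by linarith) α.2
    _ ≤ _ := by gcongr

lemma exists_lipschitz_of_hasFDerivWithinAt {R : ℝ} {f p q : ℂ → ℂ}
    (hp : ContinuousOn p (disk R)) (hq : ContinuousOn q (disk R))
    (hf : ∀ z ∈ disk R, HasFDerivWithinAt f (wirtinger (p z) (q z)) (disk R) z) :
    ∃ L, 0 ≤ L ∧ ∀ z ∈ disk R, ∀ w ∈ disk R, ‖f z - f w‖ ≤ L * ‖z - w‖ := by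
  obtain ⟨A, hA0, hA⟩ := exists_norm_le_of_continuousOn hp
  obtain ⟨B, hB0, hB⟩ := exists_norm_le_of_continuousOn hq
  refine ⟨A + B, by positivity, fun z hz w hw => ?_⟩
  refine (convex_closedBall (0 : ℂ) R).norm_image_sub_le_of_norm_hasFDerivWithin_le hf
    (fun x hx => ?_) hw hz
  refine ContinuousLinearMap.opNorm_le_bound _ (by positivity) fun v => ?_
  rw [wirtinger_apply, add_mul]
  refine (norm_add_le _ _).trans ?_
  rw [norm_mul, norm_mul, RCLike.norm_conj]
  gcongr
  exacts [hA x hx, hB x hx]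

/-! ### The derivative of the Cauchy transform -/

/-- The compressed Beurling transform `-(1/π) ∫ (f(ζ) - f(z)) / (ζ - z)²`. -/
noncomputable def beurling (R : ℝ) (f : ℂ → ℂ) (z : ℂ) : ℂ :=
  -(1 / (Real.pi : ℂ)) * ∫ ζ in disk R, (f ζ - f z) / (ζ - z) ^ 2

lemma integrableOn_sub_div_sq {α : ℝ≥0} (hα0 : 0 < α) {R : ℝ} {f : ℂ → ℂ}
    (hf : HasHolderBound α R f) {z : ℂ} (hz : z ∈ disk R) :
    IntegrableOn (fun ζ => (f ζ - f z) / (ζ - z) ^ 2) (disk R) := by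
  have hfm : AEStronglyMeasurable f (volume.restrict (disk R)) :=
    (hf.continuousOn hα0).aestronglyMeasurable (measurableSet_disk R)
  obtain ⟨C, hC0, hC⟩ := hf
  have hα0' : (0 : ℝ) < α := by exact_mod_cast hα0
  refine Integrable.mono' ((integrableOn_norm_sub_rpow (s := 2 - α) (by linarith) z R).const_mul C)
    ?_ ((ae_restrict_iff' (measurableSet_disk R)).2 (Filter.Eventually.of_forall fun ζ hζ => ?_))
  · simp only [div_eq_mul_inv]
    exact (hfm.sub aestronglyMeasurable_const).mul (Measurable.aestronglyMeasurable (by fun_prop))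
  · rcases eq_or_ne ζ z with rfl | hne
    · simp; positivity
    have h0 : 0 < ‖ζ - z‖ := norm_pos_iff.2 (sub_ne_zero.2 hne)
    rw [norm_div, norm_pow, div_le_iff₀ (by positivity)]
    refine (hC ζ hζ z hz).trans_eq ?_
    rw [mul_assoc, ← Real.rpow_natCast, ← Real.rpow_add h0]
    congr 2; push_cast; ring

lemma integral_one_div_sub {R : ℝ} (hR : 0 ≤ R) {z : ℂ} (hz : z ∈ disk R) :
    ∫ ζ in disk R, 1 / (ζ - z) = -(Real.pi * conj z) := by
  have := integral_conj_pow_mul_pow_div_sub hR 0 0 hz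
  simpa using this

/-- First order Taylor expansion of the Cauchy transform, uniform up to the boundary. -/
lemma exists_taylor_T {α : ℝ≥0} (hα0 : 0 < α) (hα1 : α < 1) {R : ℝ} (hR : 0 ≤ R) {f : ℂ → ℂ}
    (hf : HasHolderBound α R f) :
    ∃ K : ℝ, 0 ≤ K ∧ ∀ z ∈ disk R, ∀ w ∈ disk R,
      ‖T R f w - T R f z - (beurling R f z * (w - z) + f z * conj (w - z))‖ ≤
        K * ‖w - z‖ ^ (1 + α : ℝ) := by
  have hα0' : (0 : ℝ) < α := by exact_mod_cast hα0
  have hα1' : (α : ℝ) < 1 := by exact_mod_cast hα1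
  have hπ : (Real.pi : ℂ) ≠ 0 := by exact_mod_cast Real.pi_ne_zero
  obtain ⟨K, hK⟩ := exists_integral_rpow_mul_inv_le hα0' hα1'
  have hfc := hf.continuousOn hα0
  have hf' := hf
  obtain ⟨C, hC0, hC⟩ := hf
  refine ⟨C * |K|, by positivity, fun z hz w hw => ?_⟩
  rcases eq_or_ne z w with rfl | hzw
  · simp; positivity
  have hd0 : 0 < ‖w - z‖ := norm_pos_iff.2 (sub_ne_zero.2 hzw.symm)
  have hc : ContinuousOn (fun ζ => f ζ - f z) (disk R) := hfc.sub continuousOn_const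
  -- Subtracting the constant `f z` uses that `T` maps `1` to `v̄`; this is the source of the term
  -- `f(z) conj(w - z)`.
  have hsplit : ∀ v ∈ disk R, ∫ ζ in disk R, f ζ / (ζ - v) =
      (∫ ζ in disk R, (f ζ - f z) / (ζ - v)) - f z * (Real.pi * conj v) := fun v hv => by
    have h1 := integral_one_div_sub hR hv
    have h2 : ∀ ζ : ℂ, f ζ / (ζ - v) = (f ζ - f z) / (ζ - v) + f z * (1 / (ζ - v)) :=
      fun ζ => by ring
    simp only [h2]
    rw [integral_add (integrableOn_div_sub hc v)
      ((integrableOn_div_sub continuousOn_const v).const_mul _), integral_const_mul, h1]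
    ring
  -- The second order remainder of `w ↦ 1/(ζ - w)` at `z` is `(w - z)²/((ζ - w)(ζ - z)²)`; the
  -- scaling estimate then gives `|w - z|^{2 + (α - 1)}`.
  have hrep : T R f w - T R f z - (beurling R f z * (w - z) + f z * conj (w - z)) =
      -(1 / (Real.pi : ℂ)) * ((w - z) ^ 2 *
        ∫ ζ in disk R, (f ζ - f z) / ((ζ - w) * (ζ - z) ^ 2)) := by
    have h1 : ∫ ζ in disk R, ((f ζ - f z) / (ζ - w) - (f ζ - f z) / (ζ - z) -
        (w - z) * ((f ζ - f z) / (ζ - z) ^ 2)) =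
        (w - z) ^ 2 * ∫ ζ in disk R, (f ζ - f z) / ((ζ - w) * (ζ - z) ^ 2) := by
      rw [← integral_const_mul]
      refine integral_congr_ae ?_
      filter_upwards [ae_ne R z, ae_ne R w] with ζ h1 h2
      have h1' := sub_ne_zero.2 h1
      have h2' := sub_ne_zero.2 h2
      field_simp
      ring
    have hi : IntegrableOn (fun ζ => (f ζ - f z) / (ζ - w) - (f ζ - f z) / (ζ - z)) (disk R) :=
      (integrableOn_div_sub hc w).sub (integrableOn_div_sub hc z)
    rw [← h1, integral_sub hi
      ((integrableOn_sub_div_sq hα0 hf' hz).const_mul _),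
      integral_sub (integrableOn_div_sub hc w) (integrableOn_div_sub hc z), integral_const_mul,
      T_apply, T_apply, hsplit w hw, hsplit z hz, beurling, map_sub]
    field_simp
    ring
  have hbound : ‖∫ ζ in disk R, (f ζ - f z) / ((ζ - w) * (ζ - z) ^ 2)‖ ≤
      C * (K * ‖w - z‖ ^ (α - 1 : ℝ)) := by
    obtain ⟨hi, hle⟩ := hK z w hzw
    have hpt : ∀ ζ ∈ disk R, ‖(f ζ - f z) / ((ζ - w) * (ζ - z) ^ 2)‖ ≤
        C * (‖ζ - z‖ ^ (α - 2 : ℝ) * ‖ζ - w‖⁻¹) := fun ζ hζ => by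
      rcases eq_or_ne ζ z with rfl | hne
      · simp; positivity
      have h0 : 0 < ‖ζ - z‖ := norm_pos_iff.2 (sub_ne_zero.2 hne)
      rw [norm_div, norm_mul, norm_pow, div_eq_mul_inv, mul_inv]
      calc ‖f ζ - f z‖ * (‖ζ - w‖⁻¹ * (‖ζ - z‖ ^ 2)⁻¹)
          ≤ (C * ‖ζ - z‖ ^ (α : ℝ)) * (‖ζ - w‖⁻¹ * (‖ζ - z‖ ^ 2)⁻¹) := by
            gcongr; exact hC ζ hζ z hz
        _ = _ := by
            rw [Real.rpow_sub h0, Real.rpow_two]; ring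
    calc _ ≤ ∫ ζ in disk R, C * (‖ζ - z‖ ^ (α - 2 : ℝ) * ‖ζ - w‖⁻¹) :=
          norm_integral_le_of_norm_le (hi.const_mul C).integrableOn
            ((ae_restrict_iff' (measurableSet_disk R)).2 (Filter.Eventually.of_forall hpt))
      _ ≤ ∫ ζ, C * (‖ζ - z‖ ^ (α - 2 : ℝ) * ‖ζ - w‖⁻¹) :=
          setIntegral_le_integral (hi.const_mul C) (Filter.Eventually.of_forall fun ζ => by
            simp only [Pi.zero_apply]; positivity)
      _ ≤ _ := by
          rw [integral_const_mul]
          gcongr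
  rw [hrep, norm_mul, norm_mul, norm_pow, norm_neg, norm_div, norm_one, Complex.norm_real,
    Real.norm_of_nonneg Real.pi_pos.le]
  have hpi : 1 / Real.pi ≤ 1 := by
    rw [div_le_one Real.pi_pos]; linarith [Real.pi_gt_three]
  calc 1 / Real.pi * (‖w - z‖ ^ 2 * ‖∫ ζ in disk R, (f ζ - f z) / ((ζ - w) * (ζ - z) ^ 2)‖)
      ≤ 1 * (‖w - z‖ ^ 2 * (C * (|K| * ‖w - z‖ ^ (α - 1 : ℝ)))) := by
        gcongr
        refine hbound.trans ?_
        gcongr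
        exact le_abs_self K
    _ = C * |K| * (‖w - z‖ ^ (2 : ℝ) * ‖w - z‖ ^ (α - 1 : ℝ)) := by rw [Real.rpow_two]; ring
    _ = _ := by rw [← Real.rpow_add hd0]; congr 2; ring

/-- Add the Taylor expansions based at `z` and at `w`: the values of `Tf` cancel, and the difference
of the Beurling values times `z - w` is `O(|z - w|^{1+α})`. -/
lemma hasHolderBound_beurling {α : ℝ≥0} (hα0 : 0 < α) (hα1 : α < 1) {R : ℝ} (hR : 0 ≤ R)
    {f : ℂ → ℂ} (hf : HasHolderBound α R f) : HasHolderBound α R (beurling R f) := by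
  obtain ⟨K, hK0, hK⟩ := exists_taylor_T hα0 hα1 hR hf
  obtain ⟨C, hC0, hC⟩ := hf
  refine ⟨2 * K + C, by positivity, fun z hz w hw => ?_⟩
  rcases eq_or_ne z w with rfl | hzw
  · simp; positivity
  have hd0 : 0 < ‖z - w‖ := norm_pos_iff.2 (sub_ne_zero.2 hzw)
  have h1 := hK z hz w hw
  have h2 := hK w hw z hz
  rw [norm_sub_rev w z] at h1
  rw [← mul_le_mul_iff_of_pos_right hd0, ← norm_mul]
  calc ‖(beurling R f z - beurling R f w) * (z - w)‖
      = ‖(T R f w - T R f z - (beurling R f z * (w - z) + f z * conj (w - z))) +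
          (T R f z - T R f w - (beurling R f w * (z - w) + f w * conj (z - w))) -
          (f z - f w) * conj (z - w)‖ := by
        congr 1; simp only [map_sub]; ring
    _ ≤ K * ‖z - w‖ ^ (1 + α : ℝ) + K * ‖z - w‖ ^ (1 + α : ℝ) +
          (C * ‖z - w‖ ^ (α : ℝ)) * ‖z - w‖ := by
        refine (norm_sub_le _ _).trans (add_le_add ((norm_add_le _ _).trans (add_le_add h1 h2)) ?_)
        rw [norm_mul, RCLike.norm_conj]
        gcongr
        exact hC z hz w hw
    _ = _ := by rw [Real.rpow_add hd0, Real.rpow_one]; ring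

lemma hasFDerivWithinAt_T {α : ℝ≥0} (hα0 : 0 < α) (hα1 : α < 1) {R : ℝ} (hR : 0 ≤ R)
    {f : ℂ → ℂ} (hf : HasHolderBound α R f) {z : ℂ} (hz : z ∈ disk R) :
    HasFDerivWithinAt (T R f) (wirtinger (beurling R f z) (f z)) (disk R) z := by
  have hα0' : (0 : ℝ) < α := by exact_mod_cast hα0
  obtain ⟨K, hK0, hK⟩ := exists_taylor_T hα0 hα1 hR hf
  rw [hasFDerivWithinAt_iff_tendsto]
  have ht : Filter.Tendsto (fun w : ℂ => K * ‖w - z‖ ^ (α : ℝ)) (nhdsWithin z (disk R))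
      (nhds 0) := by
    have hc : Continuous fun w : ℂ => K * ‖w - z‖ ^ (α : ℝ) :=
      continuous_const.mul ((continuous_norm.comp (continuous_id.sub continuous_const)).rpow_const
        fun _ => Or.inr hα0'.le)
    have := (hc.tendsto z).mono_left (nhdsWithin_le_nhds (s := disk R))
    simpa [Real.zero_rpow hα0'.ne'] using this
  refine squeeze_zero' (Filter.Eventually.of_forall fun w => by positivity) ?_ ht
  filter_upwards [self_mem_nhdsWithin] with w hw
  rcases eq_or_ne w z with rfl | hne
  · simp; positivity
  have hd0 : 0 < ‖w - z‖ := norm_pos_iff.2 (sub_ne_zero.2 hne)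
  rw [inv_mul_le_iff₀ hd0, wirtinger_apply]
  refine (hK z hz w hw).trans_eq ?_
  rw [Real.rpow_add hd0, Real.rpow_one]; ring

/-- For a `C¹` function the Beurling transform is expressed through the Cauchy transforms of the
derivatives. -/
lemma beurling_eq {α : ℝ≥0} (hα0 : 0 < α) (hα1 : α < 1) {R : ℝ} (hR : 0 < R) {f p q : ℂ → ℂ}
    (hp : ContinuousOn p (disk R)) (hq : ContinuousOn q (disk R))
    (hf : ∀ z ∈ disk R, HasFDerivWithinAt f (wirtinger (p z) (q z)) (disk R) z) {z : ℂ}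
    (hz : z ∈ disk R) :
    beurling R f z = 1 / (R : ℂ) ^ 2 * (conj z * (conj z * f z)) + T R p z +
      -1 / (R : ℂ) ^ 2 * T R (fun ζ => conj ζ * (conj ζ * q ζ) + 2 * (conj ζ * f ζ)) z := by
  have hπ : (Real.pi : ℂ) ≠ 0 := by exact_mod_cast Real.pi_ne_zero
  have hR' : (R : ℂ) ≠ 0 := by exact_mod_cast hR.ne'
  obtain ⟨L, hL0, hL⟩ := exists_lipschitz_of_hasFDerivWithinAt hp hq hf
  have hfH : HasHolderBound α R f := .of_lipschitz hα1 hL0 hL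
  have hfc := hfH.continuousOn hα0
  have hsq := integrableOn_sub_div_sq hα0 hfH hz
  have hmc := Complex.continuous_conj.continuousOn (s := disk R)
  -- The difference quotient of `f` at `z` is bounded by the Lipschitz constant, and its `∂`
  -- contains the Beurling integrand. The subtracted `f z` returns through `T(ζ̄) = z̄²/2` as the
  -- term `z̄² f(z)/R²`.
  have key := integral_tangent_eq_zero (z := z) (C := L) hR
    (g := fun ζ => (f ζ - f z) / (ζ - z))
    (p := fun ζ => p ζ / (ζ - z) - (f ζ - f z) / (ζ - z) ^ 2) (q := fun ζ => q ζ / (ζ - z))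
    (((hfc.mono sdiff_subset).sub continuousOn_const).div (by fun_prop)
      fun ζ hζ => sub_ne_zero.2 hζ.2)
    (fun ζ hζ => by
      rw [norm_div]
      exact div_le_of_le_mul₀ (norm_nonneg _) hL0 (hL ζ hζ z hz))
    (by
      simp only [div_eq_mul_inv]
      exact ((hfc.aestronglyMeasurable (measurableSet_disk R)).sub aestronglyMeasurable_const).mul
        (Measurable.aestronglyMeasurable (by fun_prop)))
    (fun ζ hζ hne => by
      have hnhds : disk R ∈ nhds ζ := Metric.closedBall_mem_nhds_of_mem (by simpa using hζ)
      have h1 := ((hf ζ (by simp [disk, hζ.le])).hasFDerivAt hnhds).sub_const (f z)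
      have h0 : ζ - z ≠ 0 := sub_ne_zero.2 hne
      have h2 : HasDerivAt (fun ζ : ℂ => (ζ - z)⁻¹) (-1 / (ζ - z) ^ 2) ζ :=
        ((hasDerivAt_id ζ).sub_const z).inv h0
      have h3 := h1.mul (h2.hasFDerivAt.restrictScalars ℝ)
      simp only [div_eq_mul_inv] at h3 ⊢
      refine h3.congr_fderiv ?_
      ext v
      simp
      ring)
    ((integrableOn_div_sub hp z).sub hsq) (integrableOn_div_sub hq z)
  have i1 := integrableOn_div_sub hp z
  have i2 : IntegrableOn (fun ζ => (conj ζ * (conj ζ * q ζ) + 2 * (conj ζ * f ζ)) / (ζ - z))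
      (disk R) :=
    integrableOn_div_sub (by fun_prop) z
  have i3 : IntegrableOn (fun ζ : ℂ => (conj ζ - conj 0) ^ 1 / (ζ - z)) (disk R) :=
    integrableOn_div_sub (by fun_prop) z
  have e : ∀ ζ : ℂ, p ζ / (ζ - z) - (f ζ - f z) / (ζ - z) ^ 2 -
      (conj ζ ^ 2 * (q ζ / (ζ - z)) + 2 * conj ζ * ((f ζ - f z) / (ζ - z))) / (R : ℂ) ^ 2 =
      p ζ / (ζ - z) - (f ζ - f z) / (ζ - z) ^ 2 -
      (1 / (R : ℂ) ^ 2) * ((conj ζ * (conj ζ * q ζ) + 2 * (conj ζ * f ζ)) / (ζ - z)) +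
      (2 * f z / (R : ℂ) ^ 2) * ((conj ζ - conj 0) ^ 1 / (ζ - z)) := fun ζ => by
    simp only [map_zero]; ring
  simp only [e] at key
  have i4 : IntegrableOn (fun ζ => p ζ / (ζ - z) - (f ζ - f z) / (ζ - z) ^ 2) (disk R) :=
    i1.sub hsq
  have i5 : IntegrableOn (fun ζ => p ζ / (ζ - z) - (f ζ - f z) / (ζ - z) ^ 2 -
      (1 / (R : ℂ) ^ 2) * ((conj ζ * (conj ζ * q ζ) + 2 * (conj ζ * f ζ)) / (ζ - z))) (disk R) :=
    i4.sub (i2.const_mul _)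
  rw [integral_add i5 (i3.const_mul _), integral_sub i4 (i2.const_mul _), integral_sub i1 hsq, integral_const_mul,
    integral_const_mul, integral_conj_sub_pow_div_sub hR.le 0 1 hz] at key
  rw [beurling, T_apply, T_apply]
  simp only [map_zero, sub_zero, neg_zero] at key
  norm_num at key
  field_simp at key ⊢
  linear_combination key

/-! ### The classes `C^{k+α}` through Wirtinger derivatives -/

/-- The class `C^{k+α}(D)`, by recursion on `k` through the derivatives `∂` and `∂̄`. -/
def WirtingerHolder (α : ℝ≥0) (R : ℝ) : ℕ → (ℂ → ℂ) → Prop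
  | 0, f => HasHolderBound α R f
  | k + 1, f => ∃ p q : ℂ → ℂ,
      (∀ z ∈ disk R, HasFDerivWithinAt f (wirtinger (p z) (q z)) (disk R) z) ∧
        WirtingerHolder α R k p ∧ WirtingerHolder α R k q

namespace WirtingerHolder

variable {α : ℝ≥0} {R : ℝ}

lemma congr {k : ℕ} {f g : ℂ → ℂ} (hf : WirtingerHolder α R k f) (h : EqOn f g (disk R)) :
    WirtingerHolder α R k g := by
  cases k with
  | zero => exact HasHolderBound.congr hf h
  | succ k =>
    obtain ⟨p, q, hd, hp, hq⟩ := hf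
    exact ⟨p, q, fun z hz => (hd z hz).congr (fun w hw => (h hw).symm) (h hz).symm, hp, hq⟩

lemma hasHolderBound (hα0 : 0 < α) (hα1 : α < 1) {k : ℕ} {f : ℂ → ℂ}
    (hf : WirtingerHolder α R k f) : HasHolderBound α R f := by
  induction k generalizing f with
  | zero => exact hf
  | succ k ih =>
    obtain ⟨p, q, hd, hp, hq⟩ := hf
    obtain ⟨L, hL0, hL⟩ := exists_lipschitz_of_hasFDerivWithinAt ((ih hp).continuousOn hα0)
      ((ih hq).continuousOn hα0) hd
    exact .of_lipschitz hα1 hL0 hL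

lemma of_succ (hα0 : 0 < α) (hα1 : α < 1) {k : ℕ} {f : ℂ → ℂ}
    (hf : WirtingerHolder α R (k + 1) f) : WirtingerHolder α R k f := by
  induction k generalizing f with
  | zero => exact hasHolderBound hα0 hα1 hf
  | succ k ih =>
    obtain ⟨p, q, hd, hp, hq⟩ := hf
    exact ⟨p, q, hd, ih hp, ih hq⟩

lemma const (k : ℕ) (c : ℂ) : WirtingerHolder α R k fun _ => c := by
  induction k generalizing c with
  | zero => exact ⟨0, le_rfl, by simp⟩
  | succ k ih =>
    refine ⟨fun _ => 0, fun _ => 0, fun z _ => ?_, ih 0, ih 0⟩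
    exact (hasFDerivWithinAt_const c z (disk R)).congr_fderiv (by ext; simp)

lemma add {k : ℕ} {f g : ℂ → ℂ} (hf : WirtingerHolder α R k f) (hg : WirtingerHolder α R k g) :
    WirtingerHolder α R k fun z => f z + g z := by
  induction k generalizing f g with
  | zero => exact HasHolderBound.add hf hg
  | succ k ih =>
    obtain ⟨p, q, hd, hp, hq⟩ := hf
    obtain ⟨p', q', hd', hp', hq'⟩ := hg
    refine ⟨_, _, fun z hz => ?_, ih hp hp', ih hq hq'⟩
    refine ((hd z hz).add (hd' z hz)).congr_fderiv ?_
    ext v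
    simp
    ring

lemma mul (hα0 : 0 < α) (hα1 : α < 1) {k : ℕ} {f g : ℂ → ℂ} (hf : WirtingerHolder α R k f)
    (hg : WirtingerHolder α R k g) : WirtingerHolder α R k fun z => f z * g z := by
  induction k generalizing f g with
  | zero => exact HasHolderBound.mul hα0 hf hg
  | succ k ih =>
    have hf' := hf.of_succ hα0 hα1
    have hg' := hg.of_succ hα0 hα1
    obtain ⟨p, q, hd, hp, hq⟩ := hf
    obtain ⟨p', q', hd', hp', hq'⟩ := hg
    refine ⟨_, _, fun z hz => ?_, (ih hf' hp').add (ih hg' hp), (ih hf' hq').add (ih hg' hq)⟩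
    refine ((hd z hz).mul (hd' z hz)).congr_fderiv ?_
    ext v
    simp
    ring

lemma conj_comp {k : ℕ} {f : ℂ → ℂ} (hf : WirtingerHolder α R k f) :
    WirtingerHolder α R k fun z => conj (f z) := by
  induction k generalizing f with
  | zero =>
    obtain ⟨C, hC0, hC⟩ := hf
    exact ⟨C, hC0, fun z hz w hw => by rw [norm_conj_sub_conj]; exact hC z hz w hw⟩
  | succ k ih =>
    obtain ⟨p, q, hd, hp, hq⟩ := hf
    refine ⟨_, _, fun z hz => ?_, ih hq, ih hp⟩
    refine ((Complex.conjCLE : ℂ →L[ℝ] ℂ).hasFDerivAt.comp_hasFDerivWithinAt z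
      (hd z hz)).congr_fderiv ?_
    ext v
    simp
    ring

lemma conj_id (hα1 : α < 1) (k : ℕ) : WirtingerHolder α R k fun z => conj z := by
  cases k with
  | zero =>
    exact HasHolderBound.of_lipschitz hα1 zero_le_one fun z _ w _ => by
      rw [norm_conj_sub_conj, one_mul]
  | succ k =>
    refine ⟨fun _ => 0, fun _ => 1, fun z _ => ?_, const k 0, const k 1⟩
    refine (Complex.conjCLE : ℂ →L[ℝ] ℂ).hasFDerivWithinAt.congr_fderiv ?_
    ext v
    simp

/-- The Cauchy transform gains one derivative. -/
lemma cauchyTransform (hα0 : 0 < α) (hα1 : α < 1) (hR : 0 < R) {k : ℕ} {f : ℂ → ℂ}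
    (hf : WirtingerHolder α R k f) : WirtingerHolder α R (k + 1) (T R f) := by
  induction k generalizing f with
  | zero =>
    exact ⟨beurling R f, f, fun z hz => hasFDerivWithinAt_T hα0 hα1 hR.le hf hz,
      hasHolderBound_beurling hα0 hα1 hR.le hf, hf⟩
  | succ k ih =>
    -- The `∂̄` derivative is `f` itself. For the `∂` derivative, `beurling_eq` uses only `f` and
    -- Cauchy transforms of class-`k` functions, to which the induction hypothesis restores the lost
    -- derivative.
    refine ⟨beurling R f, f, fun z hz => hasFDerivWithinAt_T hα0 hα1 hR.le
      (hf.hasHolderBound hα0 hα1) hz, ?_, hf⟩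
    have hf' := hf.of_succ hα0 hα1
    have hs := hf
    obtain ⟨p, q, hd, hp, hq⟩ := hs
    have hc : ∀ j, WirtingerHolder α R j fun z => conj z := conj_id hα1
    have h1 : WirtingerHolder α R (k + 1) fun z => 1 / (R : ℂ) ^ 2 * (conj z * (conj z * f z)) :=
      mul hα0 hα1 (const _ _) (mul hα0 hα1 (hc _) (mul hα0 hα1 (hc _) hf))
    have h2 : WirtingerHolder α R k fun ζ => conj ζ * (conj ζ * q ζ) + 2 * (conj ζ * f ζ) :=
      add (mul hα0 hα1 (hc _) (mul hα0 hα1 (hc _) hq))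
        (mul hα0 hα1 (const _ _) (mul hα0 hα1 (hc _) hf'))
    refine congr (add (add h1 (ih hp)) (mul hα0 hα1 (const _ (-1 / (R : ℂ) ^ 2)) (ih h2)))
      fun z hz => ?_
    exact (beurling_eq hα0 hα1 hR ((hp.hasHolderBound hα0 hα1).continuousOn hα0)
      ((hq.hasHolderBound hα0 hα1).continuousOn hα0) hd hz).symm

lemma T_iterate (hα0 : 0 < α) (hα1 : α < 1) (hR : 0 < R) {k : ℕ} {f : ℂ → ℂ}
    (hf : WirtingerHolder α R k f) (n : ℕ) : WirtingerHolder α R (n + k) ((T R)^[n] f) := by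
  induction n with
  | zero => simpa using hf
  | succ n ih =>
    rw [Function.iterate_succ_apply', add_right_comm]
    exact ih.cauchyTransform hα0 hα1 hR

lemma Tbar_iterate (hα0 : 0 < α) (hα1 : α < 1) (hR : 0 < R) {k : ℕ} {f : ℂ → ℂ}
    (hf : WirtingerHolder α R k f) (n : ℕ) : WirtingerHolder α R (n + k) ((Tbar R)^[n] f) := by
  rw [Tbar_iterate_eq_conj]
  exact (hf.conj_comp.T_iterate hα0 hα1 hR n).conj_comp

/-! ### From Wirtinger derivatives to iterated real derivatives -/

lemma uniqueDiffOn_disk (hR : 0 < R) : UniqueDiffOn ℝ (disk R) :=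
  uniqueDiffOn_convex (convex_closedBall _ _)
    (by rw [disk, interior_closedBall _ hR.ne']; exact ⟨0, Metric.mem_ball_self hR⟩)

lemma hasHolderBound_iteratedFDerivWithin_comp {E : Type*} [NormedAddCommGroup E] [NormedSpace ℝ E]
    (hR : 0 < R) {k : ℕ} {f : ℂ → ℂ} (L : ℂ →L[ℝ] E) (hf : ContDiffOn ℝ k f (disk R))
    (h : HasHolderBound α R (iteratedFDerivWithin ℝ k f (disk R))) :
    HasHolderBound α R (iteratedFDerivWithin ℝ k (fun z => L (f z)) (disk R)) := by
  obtain ⟨C, hC0, hC⟩ := h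
  refine ⟨‖L‖ * C, by positivity, fun z hz w hw => ?_⟩
  have e : ∀ v ∈ disk R, iteratedFDerivWithin ℝ k (fun z => L (f z)) (disk R) v =
      L.compContinuousMultilinearMap (iteratedFDerivWithin ℝ k f (disk R) v) := fun v hv =>
    L.iteratedFDerivWithin_comp_left (hf v hv) (uniqueDiffOn_disk hR) hv le_rfl
  have e' : iteratedFDerivWithin ℝ k (fun z => L (f z)) (disk R) z -
      iteratedFDerivWithin ℝ k (fun z => L (f z)) (disk R) w =
      L.compContinuousMultilinearMap (iteratedFDerivWithin ℝ k f (disk R) z -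
        iteratedFDerivWithin ℝ k f (disk R) w) := by
    rw [e z hz, e w hw]; ext; simp
  rw [e']
  refine (L.norm_compContinuousMultilinearMap_le _).trans ?_
  rw [mul_assoc]
  gcongr
  exact hC z hz w hw

/-- The derivative of `f` is `L₁ p + L₂ q` with fixed real-linear maps, so its `k`-th derivative
inherits the bounds of those of `p` and `q`; currying to order `k + 1` is an isometry. -/
lemma contDiffOn_and_hasHolderBound (hα0 : 0 < α) (hR : 0 < R) {k : ℕ} {f : ℂ → ℂ}
    (hf : WirtingerHolder α R k f) :
    ContDiffOn ℝ k f (disk R) ∧ HasHolderBound α R (iteratedFDerivWithin ℝ k f (disk R)) := by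
  have hU := uniqueDiffOn_disk hR
  induction k generalizing f with
  | zero =>
    refine ⟨contDiffOn_zero.2 (HasHolderBound.continuousOn hα0 hf), ?_⟩
    obtain ⟨C, hC0, hC⟩ := hf
    refine ⟨C, hC0, fun z hz w hw => ?_⟩
    rw [← dist_eq_norm, dist_iteratedFDerivWithin_zero, dist_eq_norm]
    exact hC z hz w hw
  | succ k ih =>
    obtain ⟨p, q, hd, hp, hq⟩ := hf
    obtain ⟨hp1, hp2⟩ := ih hp
    obtain ⟨hq1, hq2⟩ := ih hq
    set L₁ : ℂ →L[ℝ] (ℂ →L[ℝ] ℂ) :=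
      (ContinuousLinearMap.toSpanSingleton ℂ (ContinuousLinearMap.id ℝ ℂ)).restrictScalars ℝ
    set L₂ : ℂ →L[ℝ] (ℂ →L[ℝ] ℂ) :=
      (ContinuousLinearMap.toSpanSingleton ℂ (Complex.conjCLE : ℂ →L[ℝ] ℂ)).restrictScalars ℝ
    have hL : ∀ z, wirtinger (p z) (q z) = L₁ (p z) + L₂ (q z) := fun z => rfl
    have c1 : ContDiffOn ℝ k (fun z => L₁ (p z)) (disk R) := hp1.continuousLinearMap_comp L₁
    have c2 : ContDiffOn ℝ k (fun z => L₂ (q z)) (disk R) := hq1.continuousLinearMap_comp L₂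
    have hD : EqOn (fun z => L₁ (p z) + L₂ (q z)) (fderivWithin ℝ f (disk R)) (disk R) :=
      fun z hz => by rw [(hd z hz).fderivWithin (hU z hz), hL]
    have hC : ContDiffOn ℝ (k + 1 : ℕ) f (disk R) := by
      push_cast
      exact contDiffOn_succ_of_fderivWithin (fun z hz => (hd z hz).differentiableWithinAt)
        (fun h => by simp at h) ((c1.add c2).congr fun z hz => (hD hz).symm)
    refine ⟨hC, ?_⟩
    have hH : HasHolderBound α R (iteratedFDerivWithin ℝ k (fderivWithin ℝ f (disk R)) (disk R)) := by
      refine ((hasHolderBound_iteratedFDerivWithin_comp hR L₁ hp1 hp2).add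
        (hasHolderBound_iteratedFDerivWithin_comp hR L₂ hq1 hq2)).congr fun z hz => ?_
      rw [← iteratedFDerivWithin_congr hD hz,
        fun_iteratedFDerivWithin_add_apply (c1 z hz) (c2 z hz) hU hz]
    obtain ⟨C, hC0, hC⟩ := hH
    refine ⟨C, hC0, fun z hz w hw => ?_⟩
    rw [iteratedFDerivWithin_succ_eq_comp_right hU hz, iteratedFDerivWithin_succ_eq_comp_right hU hw,
      Function.comp_apply, Function.comp_apply, ← dist_eq_norm, LinearIsometryEquiv.dist_map,
      dist_eq_norm]
    exact hC z hz w hw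

lemma isHolderDiff (hα0 : 0 < α) (hR : 0 < R) {k : ℕ} {f : ℂ → ℂ}
    (hf : WirtingerHolder α R k f) : IsHolderDiff k α R f :=
  have h := hf.contDiffOn_and_hasHolderBound hα0 hR
  ⟨h.1, exists_holderOnWith_iff.2 h.2⟩

end WirtingerHolder

end GreenDisk

theorem theorem2p2 (R : ℝ) (hR : 0 < R) (α : ℝ≥0) (hα0 : 0 < α) (hα1 : α < 1)
    (μ ν : ℕ) (hμ : 0 < μ) (hν : 0 < ν)
    (f : ℂ → ℂ) (hf : GreenDisk.IsHolder α R f) :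
    GreenDisk.IsHolderDiff (μ + ν) α R
        ((GreenDisk.T R)^[μ] ((GreenDisk.Tbar R)^[ν] f)) ∧
      ∀ z ∈ GreenDisk.disk R,
        MeasureTheory.IntegrableOn (fun η => GreenDisk.C₃ R z η μ ν * f η) (GreenDisk.disk R) ∧
        (GreenDisk.T R)^[μ] ((GreenDisk.Tbar R)^[ν] f) z =
          (-1) ^ μ / (((μ - 1)! : ℂ) * ((ν - 1)! : ℂ) * (2 * Real.pi * Complex.I)) *
            GreenDisk.wedgeIntegral R (fun η => GreenDisk.C₃ R z η μ ν * f η) := by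
  have hf0 : GreenDisk.WirtingerHolder α R 0 f := GreenDisk.isHolder_iff.1 hf
  have hg := hf0.Tbar_iterate hα0 hα1 hR ν
  refine ⟨(hg.T_iterate hα0 hα1 hR μ).isHolderDiff hα0 hR, fun z hz => ?_⟩
  obtain ⟨m, rfl⟩ := Nat.exists_eq_add_of_le' hμ
  obtain ⟨n, rfl⟩ := Nat.exists_eq_add_of_le' hν
  -- The regularity already obtained for `T̄^ν f` supplies the continuity required by the kernel
  -- formula for `T^μ`.
  obtain ⟨h1, h2⟩ := GreenDisk.T_iterate_Tbar_iterate_apply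
    (GreenDisk.HasHolderBound.continuousOn hα0 hf0) m n
    ((hg.hasHolderBound hα0 hα1).continuousOn hα0) hz
  refine ⟨h1, ?_⟩
  have hπ : (Real.pi : ℂ) ≠ 0 := by exact_mod_cast Real.pi_ne_zero
  have hm : (m ! : ℂ) ≠ 0 := by exact_mod_cast m.factorial_ne_zero
  have hn : (n ! : ℂ) ≠ 0 := by exact_mod_cast n.factorial_ne_zero
  rw [h2, GreenDisk.wedgeIntegral, Nat.add_sub_cancel, Nat.add_sub_cancel]
  field_simp [Complex.I_ne_zero]
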